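/- **Model.** The typical LoRa receiver is at the origin of $\mathbb R^2$; the other LoRa receivers form a homogeneous Poisson point process $\Phi_G$ of density $\lambda_G\ge 0$. The active LoRa nodes form a Matérn cluster process: the nodes served by a receiver are independent and uniformly distributed on the disc of radius $a>0$ about it. The non-LoRa nodes form a homogeneous Poisson point process $\Phi_{\rm co}$ of density $\lambda_{\rm co}\ge 0$. The typical LoRa node $x_0$ is an unordered (arbitrary) node of the cluster of the origin, hence uniformly distributed on the disc of radius $a$ about the origin. A node at $x$ with transmit power $p$ and fading coefficient $h$ is received at the origin with power $p\,h\,\eta\,\|x\|^{-\alpha}$, where $\eta>0$ and $\alpha>2$; the transmit powers are $P_{x_0}>0$ for the typical node, $P_x>0$ for all other LoRa nodes, $P_z>0$ for the non-LoRa nodes. All fading coefficients are exponentially distributed with mean $1$, and fading coefficients, positions, numbers of nodes and the two Poisson processes are mutually independent. Let $I_{\rm intra}$, $I_{\rm inter}$, $I_{\rm co}$ be the total powers received from the other nodes of the typical cluster, from the nodes of all other clusters, and from the non-LoRa nodes, and let $\sigma^2\ge0$ be the noise power. For a threshold $\gamma_{th}>0$ the coverage probability is $$P_{\rm cov}(\gamma_{th})=\Pr\Big\{\frac{P_{x_0}h_{x_0}\eta\|x_0\|^{-\alpha}}{I_{\rm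 intra}+I_{\rm inter}+I_{\rm co}+\sigma^2}\ge\gamma_{th}\Big\}.$$ Two models for the numbers of active nodes are considered. *Fixed:* every cluster has exactly $n\ge1$ active nodes (so $n-1$ nodes share the typical cluster with the typical node). *Random:* the number of active nodes in each non-typical cluster is Poisson distributed with mean $\bar n$, where $\bar n\ge 1$ is real, and the number of nodes that share the typical cluster with the typical node is Poisson distributed with mean $\bar n-1$. Put $\delta=2/\alpha$, $\rho=\rho(r)=\dfrac{r^\alpha\gamma_{th}}{P_{x_0}\eta}$, and, with the Gauss hypergeometric function ${}_2F_1$ and $B(x,y)=\int_0^\infty t^{x-1}(1+t)^{-x-y}\,dt$, $$\mathcal L_{I^n_{\rm intra}}(s)=\Big[\frac{a^\alpha\delta}{sP_x\eta(\delta+1)}\,{}_2F_1\Big(1,\delta+1;\delta+2;-\frac{a^\alpha}{sP_x\eta}\Big)\Big]^{n-1},$$ $$\mathcal L_{I^{\bar n}_{\rm intra}}(s)=\exp\Big(-(\bar n-1)\,{}_2F_1\Big(1,\delta;\delta+1;-\frac{a^\alpha}{sP_x\eta}\Big)\Big),$$ $$\mathcal L^{up}_{I^n_{\rm inter}}(s)=\exp\Big(-\pi\lambda_G(sP_x\eta)^\delta\,\delta\sum_{p=1}^n\binom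 np B(p-\delta,n-p+\delta)\Big),$$ $$\mathcal L^{low}_{I^{\bar n}_{\rm inter}}(s)=\exp\Big(-\pi^2\lambda_G\bar n(sP_x\eta)^\delta\frac{\delta}{\sin(\pi\delta)}\Big),$$ $$\mathcal L_{I_{\rm co}}(s)=\exp\big(-\pi\lambda_{\rm co}\Gamma(1+\delta)\Gamma(1-\delta)(sP_z\eta)^\delta\big).$$ **Theorem 1.** In the fixed model, for every $n\ge1$, $$P_{\rm cov}(\gamma_{th})\le\frac2{a^2}\int_0^a e^{-\rho\sigma^2}\,\mathcal L_{I^n_{\rm intra}}(\rho)\,\mathcal L^{up}_{I^n_{\rm inter}}(\rho)\,\mathcal L_{I_{\rm co}}(\rho)\,r\,dr .$$ In the random model, for every real $\bar n\ge1$, $$P_{\rm cov}(\gamma_{th})\ge\frac2{a^2}\int_0^a e^{-\rho\sigma^2}\,\mathcal L_{I^{\bar n}_{\rm intra}}(\rho)\,\mathcal L^{low}_{I^{\bar n}_{\rm inter}}(\rho)\,\mathcal L_{I_{\rm co}}(\rho)\,r\,dr .$$ Both integrals converge. -/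

import Mathlib

open MeasureTheory ProbabilityTheory
open scoped NNReal ENNReal

namespace LoRa

noncomputable section

/-! ## Point processes -/

/-- The Euclidean plane. -/
abbrev Plane : Type := EuclideanSpace ℝ (Fin 2)

/-- A point process on the plane, given by an enumeration of its (finitely or infinitely many)
points: in the outcome `ω`, the points are `point i ω` for the indices `i < count ω`. -/
structure PointProcess (Ω : Type*) where
  /-- the total number of points -/
  count : Ω → ℕ∞
  /-- the location of the `i`-th point (meaningful if `i < count ω`) -/
  point : ℕ → Ω → Plane

namespace PointProcess

variable {Ω : Type*} (Φ : PointProcess Ω)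

/-- The sum of `f i` over the indices `i` of the points of the process that are present in the
outcome `ω`. -/
def sumPoints (f : ℕ → ℝ≥0∞) (ω : Ω) : ℝ≥0∞ :=
  open scoped Classical in ∑' i : ℕ, if (i : ℕ∞) < Φ.count ω then f i else 0

/-- The number of points of the process in the set `B`. -/
def numIn (B : Set Plane) (ω : Ω) : ℝ≥0∞ :=
  Φ.sumPoints (fun i => B.indicator 1 (Φ.point i ω)) ω

/-- The σ-algebra generated by the process. -/
@[reducible] def sigma : MeasurableSpace Ω :=
  MeasurableSpace.comap Φ.count inferInstance ⊔
    ⨆ i, MeasurableSpace.comap (Φ.point i) inferInstance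

/-- `Φ` is a homogeneous Poisson point process of density `dens` on the plane: the number of
points in a Borel set `B` of finite area is Poisson distributed with mean `dens * area B`, and the
numbers of points in pairwise disjoint Borel sets of finite area are independent. -/
structure IsPoisson [MeasurableSpace Ω] (P : Measure Ω) (dens : ℝ≥0) : Prop where
  measurable_count : Measurable Φ.count
  measurable_point : ∀ i, Measurable (Φ.point i)
  hasLaw_numIn : ∀ B : Set Plane, MeasurableSet B → volume B ≠ ⊤ →
    HasLaw (Φ.numIn B)
      ((poissonMeasure (dens * (volume B).toNNReal)).map (Nat.cast : ℕ → ℝ≥0∞)) P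
  indep_numIn : ∀ (m : ℕ) (B : Fin m → Set Plane), (∀ k, MeasurableSet (B k)) →
    (∀ k, volume (B k) ≠ ⊤) → Pairwise (fun k l => Disjoint (B k) (B l)) →
    iIndepFun (fun k => Φ.numIn (B k)) P

end PointProcess

/-! ## The network -/

/-- The law of a point that is uniformly distributed on the disc of radius `r` about the origin. -/
def uniformDisc (r : ℝ) : Measure Plane :=
  ProbabilityTheory.cond volume (Metric.closedBall (0 : Plane) r)

/-- The parameters of the network. -/
structure Params where
  /-- cluster radius -/
  a : ℝ
  /-- path loss exponent -/
  α : ℝ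
  /-- frequency dependent factor of the path loss -/
  η : ℝ
  /-- transmit power of the typical LoRa node -/
  Px₀ : ℝ
  /-- transmit power of the interfering LoRa nodes -/
  Px : ℝ
  /-- transmit power of the non-LoRa nodes -/
  Pz : ℝ
  /-- `σ ^ 2` is the noise power -/
  σ : ℝ
  /-- density of the LoRa receivers -/
  densG : ℝ≥0
  /-- density of the non-LoRa nodes -/
  densCo : ℝ≥0
  a_pos : 0 < a
  two_lt_α : 2 < α
  η_pos : 0 < η
  Px₀_pos : 0 < Px₀
  Px_pos : 0 < Px
  Pz_pos : 0 < Pz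

/-- The random quantities of the network, seen from the typical LoRa receiver, which is placed at
the origin. -/
structure Network (Ω : Type*) where
  /-- location of the typical LoRa node -/
  x₀ : Ω → Plane
  /-- fading coefficient of the typical LoRa node -/
  h₀ : Ω → ℝ
  /-- number of the other active LoRa nodes in the typical cluster -/
  numIntra : Ω → ℕ
  /-- location of the `j`-th other node of the typical cluster (present if `j < numIntra ω`) -/
  xIntra : ℕ → Ω → Plane
  /-- fading coefficient of that node -/
  hIntra : ℕ → Ω → ℝ
  /-- the LoRa receivers other than the typical one -/
  receivers : PointProcess Ω
  /-- number of active LoRa nodes in the cluster of the `i`-th other receiver -/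
  numInter : ℕ → Ω → ℕ
  /-- displacement from the `i`-th other receiver to the `j`-th node of its cluster (present if
  `j < numInter i ω`) -/
  xInter : ℕ → ℕ → Ω → Plane
  /-- fading coefficient (towards the typical receiver) of that node -/
  hInter : ℕ → ℕ → Ω → ℝ
  /-- the non-LoRa nodes -/
  nonLoRa : PointProcess Ω
  /-- fading coefficient of the `i`-th non-LoRa node -/
  hCo : ℕ → Ω → ℝ

/-- Labels of the independent sources of randomness of the network. -/
inductive Source where
  | x₀ | h₀ | numIntra
  | xIntra (j : ℕ) | hIntra (j : ℕ)
  | receivers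
  | numInter (i : ℕ) | xInter (i j : ℕ) | hInter (i j : ℕ)
  | nonLoRa
  | hCo (i : ℕ)

/-- The large-scale fading coefficient times transmit power times small-scale fading coefficient:
the power `p h η ‖x‖ ^ (-α)` received at the origin from a node at `x` that transmits with power
`p` and has fading coefficient `h`. -/
def Params.receivedPower (S : Params) (p h : ℝ) (x : Plane) : ℝ≥0∞ :=
  ENNReal.ofReal (p * h * S.η) * ‖x‖ₑ ^ (-S.α)

namespace Network

variable {Ω : Type*} (X : Network Ω)

/-- The σ-algebra generated by each source of randomness. -/
@[reducible] def sigma : Source → MeasurableSpace Ω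
  | .x₀ => MeasurableSpace.comap X.x₀ inferInstance
  | .h₀ => MeasurableSpace.comap X.h₀ inferInstance
  | .numIntra => MeasurableSpace.comap X.numIntra inferInstance
  | .xIntra j => MeasurableSpace.comap (X.xIntra j) inferInstance
  | .hIntra j => MeasurableSpace.comap (X.hIntra j) inferInstance
  | .receivers => X.receivers.sigma
  | .numInter i => MeasurableSpace.comap (X.numInter i) inferInstance
  | .xInter i j => MeasurableSpace.comap (X.xInter i j) inferInstance
  | .hInter i j => MeasurableSpace.comap (X.hInter i j) inferInstance
  | .nonLoRa => X.nonLoRa.sigma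
  | .hCo i => MeasurableSpace.comap (X.hCo i) inferInstance

/-- `X` is a network with parameters `S` in which the LoRa nodes form a Matérn cluster process:
the LoRa receivers form a Poisson point process, the nodes of each cluster are uniformly
distributed on the disc of radius `a` about their receiver, the non-LoRa nodes form a Poisson point
process, all fading coefficients are exponentially distributed with mean `1`, and all these random
quantities are independent. The law of the number of active nodes of a cluster is `ν`; the law of
the number of nodes that share the typical cluster with the typical node is `ν₀`. -/
structure IsMatern [MeasurableSpace Ω] (P : Measure Ω) (S : Params) (ν₀ ν : Measure ℕ) :
    Prop where
  measurable_x₀ : Measurable X.x₀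
  measurable_h₀ : Measurable X.h₀
  measurable_numIntra : Measurable X.numIntra
  measurable_xIntra : ∀ j, Measurable (X.xIntra j)
  measurable_hIntra : ∀ j, Measurable (X.hIntra j)
  measurable_numInter : ∀ i, Measurable (X.numInter i)
  measurable_xInter : ∀ i j, Measurable (X.xInter i j)
  measurable_hInter : ∀ i j, Measurable (X.hInter i j)
  measurable_hCo : ∀ i, Measurable (X.hCo i)
  law_x₀ : HasLaw X.x₀ (uniformDisc S.a) P
  law_h₀ : HasLaw X.h₀ (expMeasure 1) P
  law_numIntra : HasLaw X.numIntra ν₀ P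
  law_xIntra : ∀ j, HasLaw (X.xIntra j) (uniformDisc S.a) P
  law_hIntra : ∀ j, HasLaw (X.hIntra j) (expMeasure 1) P
  receivers_poisson : X.receivers.IsPoisson P S.densG
  law_numInter : ∀ i, HasLaw (X.numInter i) ν P
  law_xInter : ∀ i j, HasLaw (X.xInter i j) (uniformDisc S.a) P
  law_hInter : ∀ i j, HasLaw (X.hInter i j) (expMeasure 1) P
  nonLoRa_poisson : X.nonLoRa.IsPoisson P S.densCo
  law_hCo : ∀ i, HasLaw (X.hCo i) (expMeasure 1) P
  indep : iIndep X.sigma P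

/-- Matérn cluster network in which every cluster, the typical one included, has exactly `n` active
nodes. -/
def IsMaternFixed [MeasurableSpace Ω] (P : Measure Ω) (S : Params) (n : ℕ) : Prop :=
  X.IsMatern P S (Measure.dirac (n - 1)) (Measure.dirac n)

/-- Matérn cluster network in which the number of active nodes of a cluster is Poisson distributed
with mean `nbar`, and the number of nodes that interfere with the typical node from within its own
cluster is Poisson distributed with mean `nbar - 1` (so that the mean number of active nodes is
`nbar` in the typical cluster, too). Used for `1 ≤ nbar` only. -/
def IsMaternPoisson [MeasurableSpace Ω] (P : Measure Ω) (S : Params) (nbar : ℝ≥0) : Prop :=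
  X.IsMatern P S (poissonMeasure (nbar - 1)) (poissonMeasure nbar)

variable (S : Params)

/-- Intra-cluster interference. -/
def Iintra (ω : Ω) : ℝ≥0∞ :=
  ∑ j ∈ Finset.range (X.numIntra ω), S.receivedPower S.Px (X.hIntra j ω) (X.xIntra j ω)

/-- Inter-cluster interference. -/
def Iinter (ω : Ω) : ℝ≥0∞ :=
  X.receivers.sumPoints (fun i => ∑ j ∈ Finset.range (X.numInter i ω),
    S.receivedPower S.Px (X.hInter i j ω) (X.receivers.point i ω + X.xInter i j ω)) ω

/-- Coexistence interference. -/
def Ico (ω : Ω) : ℝ≥0∞ :=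
  X.nonLoRa.sumPoints (fun i => S.receivedPower S.Pz (X.hCo i ω) (X.nonLoRa.point i ω)) ω

/-- The signal-to-interference-plus-noise ratio of the typical node at its receiver. -/
def sinr (ω : Ω) : ℝ≥0∞ :=
  S.receivedPower S.Px₀ (X.h₀ ω) (X.x₀ ω) /
    (X.Iintra S ω + X.Iinter S ω + X.Ico S ω + ENNReal.ofReal (S.σ ^ 2))

/-- The coverage probability of the typical node for the SINR threshold `γ`. -/
def coverageProb [MeasurableSpace Ω] (P : Measure Ω) (γ : ℝ) : ℝ :=
  P.real {ω | ENNReal.ofReal γ ≤ X.sinr S ω}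

end Network

/-! ## Special functions and the formulas -/

/-- The Gauss hypergeometric function `₂F₁(a, b; c; z)` for `0 < b < c` and `z < 1`, by Euler's
integral (the power series converges for `|z| < 1` only). -/
def gaussHyp (a b c z : ℝ) : ℝ :=
  Real.Gamma c / (Real.Gamma b * Real.Gamma (c - b)) *
    ∫ t in (0 : ℝ)..1, t ^ (b - 1) * (1 - t) ^ (c - b - 1) * (1 - z * t) ^ (-a)

/-- The Beta function, for `0 < x` and `0 < y`. -/
def betaFn (x y : ℝ) : ℝ :=
  ∫ t in Set.Ioi (0 : ℝ), t ^ (x - 1) / (1 + t) ^ (x + y)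

namespace Params

variable (S : Params)

/-- `δ = 2 / α`. -/
def δ : ℝ := 2 / S.α

/-- `ρ = r ^ α γ / (P_{x₀} η)`, for a typical node at distance `r`. -/
def ρ (γ r : ℝ) : ℝ := r ^ S.α * γ / (S.Px₀ * S.η)

/-- Laplace transform of the intra-cluster interference, `n` nodes per cluster. -/
def lapIntraFixed (n : ℕ) (s : ℝ) : ℝ :=
  (S.a ^ S.α * S.δ / (s * S.Px * S.η * (S.δ + 1)) *
    gaussHyp 1 (S.δ + 1) (S.δ + 2) (-(S.a ^ S.α / (s * S.Px * S.η)))) ^ (n - 1)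

/-- Laplace transform of the intra-cluster interference, on average `nbar` nodes per cluster. -/
def lapIntraPoisson (nbar s : ℝ) : ℝ :=
  Real.exp (-((nbar - 1) * gaussHyp 1 S.δ (S.δ + 1) (-(S.a ^ S.α / (s * S.Px * S.η)))))

/-- Upper bound for the Laplace transform of the inter-cluster interference, `n` nodes per
cluster. -/
def lapInterUp (n : ℕ) (s : ℝ) : ℝ :=
  Real.exp (-(Real.pi * S.densG * (s * S.Px * S.η) ^ S.δ * S.δ *
    ∑ p ∈ Finset.Icc 1 n, (n.choose p : ℝ) * betaFn (p - S.δ) (n - p + S.δ)))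

/-- Lower bound for the Laplace transform of the inter-cluster interference, on average `nbar` nodes
per cluster. -/
def lapInterLow (nbar s : ℝ) : ℝ :=
  Real.exp (-(Real.pi ^ 2 * S.densG * nbar * (s * S.Px * S.η) ^ S.δ *
    (S.δ / Real.sin (Real.pi * S.δ))))

/-- Laplace transform of the coexistence interference. -/
def lapCo (s : ℝ) : ℝ :=
  Real.exp (-(Real.pi * S.densCo * Real.Gamma (1 + S.δ) * Real.Gamma (1 - S.δ) *
    (s * S.Pz * S.η) ^ S.δ))

/-- The integrand of the bound for `n` nodes per cluster. -/
def integrandUp (n : ℕ) (γ r : ℝ) : ℝ :=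
  Real.exp (-(S.ρ γ r * S.σ ^ 2)) * S.lapIntraFixed n (S.ρ γ r) * S.lapInterUp n (S.ρ γ r) *
    S.lapCo (S.ρ γ r) * r

/-- The integrand of the bound for on average `nbar` nodes per cluster. -/
def integrandLow (nbar γ r : ℝ) : ℝ :=
  Real.exp (-(S.ρ γ r * S.σ ^ 2)) * S.lapIntraPoisson nbar (S.ρ γ r) *
    S.lapInterLow nbar (S.ρ γ r) * S.lapCo (S.ρ γ r) * r

end Params

end

end LoRa

/-!
The coverage event is `h₀ ≥ ρ (I + σ ^ 2)`, where `I` is the total interference and `h₀` is an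
independent exponential variable; hence the coverage probability is the average, over the position
`x₀` of the typical node, of the Laplace transform of `I + σ ^ 2` at `ρ ‖x₀‖`. By independence this
transform factors. With `V x` the Laplace transform of the power received from one node of the
cluster of a receiver at `x`, averaged over the disc, the intra-cluster factor is `E (V 0) ^ N₀`,
and the Laplace functional of a marked Poisson process gives `exp (-λ ∫ (1 - E (V x) ^ N) dx)` for
the inter-cluster factor.

For `N = n`, Jensen's inequality bounds `(V x) ^ n` by the disc average of the `n`-th powers, and
the translation invariance of the area removes that average. For Poisson distributed `N`, the
inequality `1 - exp (-u) ≤ u` has the same effect. The remaining integrals are radial: over the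
plane they are Beta integrals, the case `n = 1` being `Γ(δ) Γ(1 - δ) = π / sin (π δ)`, and over the
disc they are Euler integrals of `₂F₁`.
-/

namespace LoRa

open Filter Topology Set

/-! ## The exponential `exp (-x)` on `[0, ∞]` -/

/-- The function `x ↦ exp (-x)` on `[0, ∞]`, with `exp (-∞) = 0`. Laplace transforms are
expectations of `expNeg`, so that infinite interference needs no special treatment. -/
noncomputable def expNeg (x : ℝ≥0∞) : ℝ≥0∞ := EReal.exp (-(x : EReal))

@[simp] lemma expNeg_zero : expNeg 0 = 1 := by simp [expNeg]

@[simp] lemma expNeg_top : expNeg ⊤ = 0 := by simp [expNeg]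

lemma continuous_expNeg : Continuous expNeg :=
  ENNReal.continuous_exp.comp (continuous_neg.comp continuous_coe_ennreal_ereal)

@[fun_prop]
lemma measurable_expNeg : Measurable expNeg := continuous_expNeg.measurable

lemma antitone_expNeg : Antitone expNeg := fun _ _ h =>
  EReal.exp_monotone (EReal.neg_le_neg_iff.2 (EReal.coe_ennreal_le_coe_ennreal_iff.2 h))

lemma expNeg_le_one (x : ℝ≥0∞) : expNeg x ≤ 1 := by
  simpa using antitone_expNeg (zero_le (a := x))

lemma expNeg_add (x y : ℝ≥0∞) : expNeg (x + y) = expNeg x * expNeg y := by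
  rw [expNeg, EReal.coe_ennreal_add, EReal.neg_add (by simp) (by simp), sub_eq_add_neg,
    EReal.exp_add]
  rfl

lemma expNeg_sum {ι : Type*} (s : Finset ι) (f : ι → ℝ≥0∞) :
    expNeg (∑ i ∈ s, f i) = ∏ i ∈ s, expNeg (f i) := by
  classical
  induction s using Finset.induction_on with
  | empty => simp
  | insert a s ha ih => rw [Finset.sum_insert ha, Finset.prod_insert ha, expNeg_add, ih]

lemma expNeg_mul_natCast (x : ℝ≥0∞) (k : ℕ) : expNeg (x * k) = expNeg x ^ k := by
  simpa [mul_comm] using expNeg_sum (Finset.range k) fun _ => x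

lemma expNeg_ofReal {t : ℝ} (ht : 0 ≤ t) :
    expNeg (ENNReal.ofReal t) = ENNReal.ofReal (Real.exp (-t)) := by
  rw [expNeg, EReal.coe_ennreal_ofReal, max_eq_left ht, ← EReal.coe_neg, EReal.exp_coe]

lemma one_sub_expNeg_le (x : ℝ≥0∞) : 1 - expNeg x ≤ x := by
  by_cases hx : x = ⊤
  · simp [hx]
  lift x to ℝ≥0 using hx
  rw [← ENNReal.ofReal_coe_nnreal, expNeg_ofReal x.coe_nonneg, ← ENNReal.ofReal_one,
    ← ENNReal.ofReal_sub _ (Real.exp_pos _).le]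
  exact ENNReal.ofReal_le_ofReal (by linarith [Real.add_one_le_exp (-(x : ℝ))])

/-- The function `x ↦ -log x` on `[0, ∞]`, truncated at `0`: the inverse of `expNeg` on
`[0, 1]`. -/
noncomputable def negLog (x : ℝ≥0∞) : ℝ≥0∞ := (-ENNReal.log x).toENNReal

lemma expNeg_negLog {x : ℝ≥0∞} (hx : x ≤ 1) : expNeg (negLog x) = x := by
  have h : 0 ≤ -ENNReal.log x := by
    rw [EReal.le_neg, neg_zero]
    simpa using ENNReal.log_monotone hx
  rw [expNeg, negLog, EReal.coe_toENNReal h, neg_neg, ENNReal.exp_log]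

@[simp] lemma negLog_one : negLog 1 = 0 := by simp [negLog]

@[fun_prop]
lemma measurable_negLog : Measurable negLog :=
  (EReal.continuous_toENNReal.comp (continuous_neg.comp ENNReal.continuous_log)).measurable

section LaplaceTransform

variable {Ω : Type*} [MeasurableSpace Ω] {P : Measure Ω}

lemma lintegral_expNeg_le_one [IsProbabilityMeasure P] (f : Ω → ℝ≥0∞) : ∫⁻ ω, expNeg (f ω) ∂P ≤ 1 :=
  (lintegral_mono fun ω => expNeg_le_one (f ω)).trans (by simp)

lemma tendsto_lintegral_expNeg [IsFiniteMeasure P] {f : ℕ → Ω → ℝ≥0∞} {g : Ω → ℝ≥0∞}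
    (hf : ∀ n, Measurable (f n))
    (hlim : ∀ ω, Tendsto (fun n => f n ω) atTop (𝓝 (g ω))) :
    Tendsto (fun n => ∫⁻ ω, expNeg (f n ω) ∂P) atTop (𝓝 (∫⁻ ω, expNeg (g ω) ∂P)) :=
  tendsto_lintegral_of_dominated_convergence (fun _ => 1)
    (fun n => measurable_expNeg.comp (hf n)) (fun _ => ae_of_all _ fun _ => expNeg_le_one _)
    (by simp) (ae_of_all _ fun ω => (continuous_expNeg.tendsto _).comp (hlim ω))

lemma lintegral_expNeg_add {f g : Ω → ℝ≥0∞} (hf : Measurable f) (hg : Measurable g)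
    (h : IndepFun f g P) :
    ∫⁻ ω, expNeg (f ω + g ω) ∂P = (∫⁻ ω, expNeg (f ω) ∂P) * ∫⁻ ω, expNeg (g ω) ∂P := by
  simp_rw [expNeg_add]
  exact lintegral_mul_eq_lintegral_mul_lintegral_of_indepFun (measurable_expNeg.comp hf)
    (measurable_expNeg.comp hg) (h.comp measurable_expNeg measurable_expNeg)

lemma lintegral_expNeg_finsetSum {ι : Type*} {f : ι → Ω → ℝ≥0∞} (hf : ∀ i, Measurable (f i))
    (h : iIndepFun f P) (s : Finset ι) :
    ∫⁻ ω, expNeg (∑ i ∈ s, f i ω) ∂P = ∏ i ∈ s, ∫⁻ ω, expNeg (f i ω) ∂P := by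
  simp_rw [expNeg_sum]
  exact lintegral_prod_eq_prod_lintegral_of_indepFun s (fun i ω => expNeg (f i ω))
    (h.comp (fun _ => expNeg) fun _ => measurable_expNeg) fun i => measurable_expNeg.comp (hf i)

lemma lintegral_expNeg_tsum {f : ℕ → Ω → ℝ≥0∞} (hf : ∀ i, Measurable (f i))
    (h : iIndepFun f P) :
    ∫⁻ ω, expNeg (∑' i, f i ω) ∂P = expNeg (∑' i, negLog (∫⁻ ω, expNeg (f i ω) ∂P)) := by
  have : IsProbabilityMeasure P := h.isProbabilityMeasure
  refine tendsto_nhds_unique (tendsto_lintegral_expNeg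
    (f := fun k ω => ∑ i ∈ Finset.range k, f i ω) (fun k => by fun_prop)
    fun ω => ENNReal.tendsto_nat_tsum _) ?_
  simp_rw [lintegral_expNeg_finsetSum hf h]
  refine ((continuous_expNeg.tendsto _).comp (ENNReal.tendsto_nat_tsum _)).congr fun k => ?_
  rw [Function.comp_apply, expNeg_sum]
  exact Finset.prod_congr rfl fun i _ => expNeg_negLog (lintegral_expNeg_le_one _)

end LaplaceTransform

/-! ## Independence -/

section Independence

variable {Ω ι κ α β : Type*} [MeasurableSpace α] [MeasurableSpace β]

section Blocks

variable {m : ι → MeasurableSpace Ω}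

lemma measurable_biSup_of_mem {f : Ω → α} {T : Set ι} {i : ι} (hi : i ∈ T)
    (hf : Measurable[m i] f) : Measurable[⨆ k ∈ T, m k] f :=
  hf.mono (le_biSup m hi) le_rfl

variable [mΩ : MeasurableSpace Ω] {P : Measure Ω}

lemma indepFun_of_iIndep (hm : ∀ i, m i ≤ mΩ) (h : iIndep m P) {S T : Set ι} (hST : Disjoint S T)
    {f : Ω → α} {g : Ω → β} (hf : Measurable[⨆ i ∈ S, m i] f) (hg : Measurable[⨆ i ∈ T, m i] g) :
    IndepFun f g P :=
  indep_of_indep_of_le_left (indep_of_indep_of_le_right (indep_iSup_of_disjoint hm h hST)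
    (measurable_iff_comap_le.1 hg)) (measurable_iff_comap_le.1 hf)

lemma iIndep_biSup_of_pairwise_disjoint (hm : ∀ i, m i ≤ mΩ) (h : iIndep m P) {S : κ → Set ι}
    (hS : Pairwise (Function.onFun Disjoint S)) : iIndep (fun k => ⨆ i ∈ S k, m i) P := by
  classical
  have : IsProbabilityMeasure P := h.isProbabilityMeasure
  rw [iIndep_iff]
  intro s A hA
  induction s using Finset.induction_on with
  | empty => simp
  | insert k s hk ih =>
    have hdisj : Disjoint (S k) (⋃ l ∈ s, S l) := by
      simp only [disjoint_iUnion_right]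
      exact fun l hl => hS fun hkl => hk (hkl ▸ hl)
    have hrest : MeasurableSet[⨆ i ∈ ⋃ l ∈ s, S l, m i] (⋂ l ∈ s, A l) :=
      Finset.measurableSet_biInter s fun l hl =>
        (biSup_mono fun i hi => mem_biUnion hl hi : ⨆ i ∈ S l, m i ≤ _) _
          (hA l (Finset.mem_insert_of_mem hl))
    rw [Finset.set_biInter_insert, Finset.prod_insert hk,
      ← ih fun l hl => hA l (Finset.mem_insert_of_mem hl)]
    exact (Indep_iff _ _ _).1 (indep_iSup_of_disjoint hm h hdisj) _ _
      (hA k (Finset.mem_insert_self k s)) hrest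

lemma iIndepFun_of_iIndep (hm : ∀ i, m i ≤ mΩ) (h : iIndep m P) {S : κ → Set ι}
    (hS : Pairwise (Function.onFun Disjoint S)) {f : κ → Ω → α}
    (hf : ∀ k, Measurable[⨆ i ∈ S k, m i] (f k)) : iIndepFun f P :=
  iIndep_of_iIndep_of_le (iIndep_biSup_of_pairwise_disjoint hm h hS)
    fun k => measurable_iff_comap_le.1 (hf k)

end Blocks

variable [MeasurableSpace Ω] {P : Measure Ω}

lemma lintegral_comp_of_indepFun [IsFiniteMeasure P] {f : Ω → α} {g : Ω → β}
    (hf : Measurable f) (hg : Measurable g) (h : IndepFun f g P) {F : α → β → ℝ≥0∞}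
    (hF : Measurable (Function.uncurry F)) :
    ∫⁻ ω, F (f ω) (g ω) ∂P = ∫⁻ ω, ∫⁻ ω', F (f ω) (g ω') ∂P ∂P := by
  calc ∫⁻ ω, F (f ω) (g ω) ∂P
      = ∫⁻ p, Function.uncurry F p ∂(P.map fun ω => (f ω, g ω)) :=
        (lintegral_map hF (hf.prodMk hg)).symm
    _ = ∫⁻ x, ∫⁻ y, F x y ∂(P.map g) ∂(P.map f) := by
        rw [(indepFun_iff_map_prod_eq_prod_map_map hf.aemeasurable hg.aemeasurable).1 h,
          lintegral_prod _ hF.aemeasurable]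
        rfl
    _ = ∫⁻ ω, ∫⁻ ω', F (f ω) (g ω') ∂P ∂P := by
        rw [lintegral_map hF.lintegral_prod_right hf]
        exact lintegral_congr fun ω => lintegral_map (hF.comp measurable_prodMk_left) hg

lemma lintegral_expNeg_sum_range {N : Ω → ℕ} {f : ℕ → Ω → ℝ≥0∞} {V : ℝ≥0∞} (hN : Measurable N)
    (hf : ∀ i, Measurable (f i)) (hindep : iIndepFun f P)
    (hNf : IndepFun N (fun ω i => f i ω) P) (hV : ∀ i, ∫⁻ ω, expNeg (f i ω) ∂P = V) :
    ∫⁻ ω, expNeg (∑ i ∈ Finset.range (N ω), f i ω) ∂P = ∫⁻ ω, V ^ N ω ∂P := by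
  have : IsProbabilityMeasure P := hindep.isProbabilityMeasure
  rw [lintegral_comp_of_indepFun hN (measurable_pi_lambda _ hf) hNf
    (F := fun k u => expNeg (∑ i ∈ Finset.range k, u i))
    (measurable_from_prod_countable_right fun k => by
      simp only [Function.uncurry_apply_pair]; fun_prop)]
  simp_rw [lintegral_expNeg_finsetSum hf hindep, hV, Finset.prod_const, Finset.card_range]

end Independence

/-! ## Laplace functionals of Poisson point processes -/

lemma lintegral_pow_poissonMeasure (r : ℝ≥0) {q : ℝ≥0∞} (hq : q ≤ 1) :
    ∫⁻ k, q ^ k ∂(poissonMeasure r) = expNeg (r * (1 - q)) := by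
  lift q to ℝ≥0 using (hq.trans_lt ENNReal.one_lt_top).ne
  have hq' : (q : ℝ) ≤ 1 := by exact_mod_cast hq
  have hexponent : (r : ℝ≥0∞) * (1 - q) = ENNReal.ofReal (r * (1 - q)) := by
    rw [ENNReal.ofReal_mul r.coe_nonneg, ENNReal.ofReal_sub _ q.coe_nonneg]
    simp
  have hseries : HasSum (fun k : ℕ => Real.exp (-r) * r ^ k / k.factorial * (q : ℝ) ^ k)
      (Real.exp (-(r * (1 - q)))) := by
    convert! (NormedSpace.expSeries_div_hasSum_exp ((r : ℝ) * q)).mul_left (Real.exp (-r)) using 1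
    · ext k
      rw [mul_pow]
      ring
    · rw [← Real.exp_eq_exp_ℝ, ← Real.exp_add]
      ring_nf
  rw [hexponent, expNeg_ofReal (mul_nonneg r.coe_nonneg (by linarith)), ← hseries.tsum_eq,
    ENNReal.ofReal_tsum_of_nonneg (fun k => by positivity) hseries.summable, poissonMeasure,
    lintegral_sum_measure]
  refine tsum_congr fun k => ?_
  rw [lintegral_smul_measure, lintegral_dirac, ENNReal.ofReal_mul (by positivity),
    ENNReal.ofReal_pow q.coe_nonneg, ENNReal.ofReal_coe_nnreal, smul_eq_mul]

open scoped Classical in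
/-- The sum of the first `c` terms of a sequence, where `c` may be infinite; `sumPoints` is
`sumUpTo` with the random bound `c = Φ.count ω`. -/
noncomputable def sumUpTo (c : ℕ∞) (u : ℕ → ℝ≥0∞) : ℝ≥0∞ :=
  ∑' i : ℕ, if (i : ℕ∞) < c then u i else 0

@[fun_prop]
lemma measurable_sumUpTo : Measurable (Function.uncurry sumUpTo) := by
  refine Measurable.tsum fun i => Measurable.ite ?_ ?_ measurable_const
  · exact measurable_fst (MeasurableSet.of_discrete (s := {c : ℕ∞ | (i : ℕ∞) < c}))
  · exact (measurable_pi_apply i).comp measurable_snd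

lemma sumUpTo_finsetSum {κ : Type*} (s : Finset κ) (c : ℕ∞) (u : κ → ℕ → ℝ≥0∞) :
    sumUpTo c (fun i => ∑ k ∈ s, u k i) = ∑ k ∈ s, sumUpTo c (u k) := by
  unfold sumUpTo
  rw [← Summable.tsum_finsetSum fun _ _ => ENNReal.summable]
  refine tsum_congr fun i => ?_
  split_ifs <;> simp

lemma sumUpTo_const_mul (a : ℝ≥0∞) (c : ℕ∞) (u : ℕ → ℝ≥0∞) :
    sumUpTo c (fun i => a * u i) = a * sumUpTo c u := by
  unfold sumUpTo
  rw [← ENNReal.tsum_mul_left]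
  exact tsum_congr fun i => by split_ifs <;> simp

lemma tendsto_sumUpTo {c : ℕ∞} {u : ℕ → ℕ → ℝ≥0∞} {v : ℕ → ℝ≥0∞} (hu : Monotone u)
    (hv : ∀ i, Tendsto (fun n => u n i) atTop (𝓝 (v i))) :
    Tendsto (fun n => sumUpTo c (u n)) atTop (𝓝 (sumUpTo c v)) := by
  unfold sumUpTo
  simp_rw [← lintegral_count]
  refine lintegral_tendsto_of_tendsto_of_monotone (fun n => Measurable.of_discrete.aemeasurable)
    (ae_of_all _ fun i n k hnk => ?_) (ae_of_all _ fun i => ?_)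
  · dsimp only
    split_ifs
    exacts [hu hnk i, le_rfl]
  · split_ifs
    exacts [hv i, tendsto_const_nhds]

lemma lintegral_expNeg_sumUpTo {Ω : Type*} [MeasurableSpace Ω] {P : Measure Ω}
    {f : ℕ → Ω → ℝ≥0∞} (hf : ∀ i, Measurable (f i)) (h : iIndepFun f P) (c : ℕ∞) :
    ∫⁻ ω, expNeg (sumUpTo c fun i => f i ω) ∂P =
      expNeg (sumUpTo c fun i => negLog (∫⁻ ω, expNeg (f i ω) ∂P)) := by
  classical
  have : IsProbabilityMeasure P := h.isProbabilityMeasure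
  have hkeep : ∀ i : ℕ, Measurable fun x : ℝ≥0∞ => if (i : ℕ∞) < c then x else 0 := fun i => by
    split_ifs <;> fun_prop
  have hterms := lintegral_expNeg_tsum (fun i => (hkeep i).comp (hf i)) (h.comp _ hkeep)
  simp only [Function.comp_apply] at hterms
  simp only [sumUpTo, hterms]
  congr 1
  refine tsum_congr fun i => ?_
  split_ifs <;> simp

lemma one_sub_expNeg_sum_indicator {α κ : Type*} [Fintype κ] {B : κ → Set α}
    (hdisj : Pairwise (Function.onFun Disjoint B)) (c : κ → ℝ≥0∞) (x : α) :
    1 - expNeg (∑ j, c j * (B j).indicator 1 x) =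
      ∑ j, (B j).indicator (fun _ => 1 - expNeg (c j)) x := by
  by_cases hx : ∃ j, x ∈ B j
  · obtain ⟨j, hj⟩ := hx
    have hother : ∀ i, i ≠ j → x ∉ B i := fun i hij hi => disjoint_left.1 (hdisj hij) hi hj
    rw [Fintype.sum_eq_single j fun i hij => by simp [hother i hij],
      Fintype.sum_eq_single j fun i hij => by simp [hother i hij]]
    simp [hj]
  · push Not at hx
    simp [hx]

lemma sum_range_filter_mul_indicator {α : Type*} [MeasurableSpace α] [DecidableEq ℝ≥0∞]
    (g : SimpleFunc α ℝ≥0∞) (x : α) :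
    ∑ y ∈ g.range with y ≠ 0, y * (g ⁻¹' {y}).indicator 1 x = g x := by
  by_cases hx : g x = 0
  · rw [hx]
    refine Finset.sum_eq_zero fun y hy => ?_
    have hy' : g x ≠ y := fun h => (Finset.mem_filter.1 hy).2 (h ▸ hx)
    simp [hy']
  · rw [Finset.sum_eq_single_of_mem (g x) (by simp [hx]) fun y _ hy => by simp [hy.symm]]
    simp

namespace PointProcess

variable {Ω : Type*} {Φ : PointProcess Ω}

lemma sumPoints_eq_sumUpTo (f : ℕ → ℝ≥0∞) (ω : Ω) : Φ.sumPoints f ω = sumUpTo (Φ.count ω) f := rfl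

lemma measurable_count_point :
    Measurable[Φ.sigma] fun ω => (Φ.count ω, fun i => Φ.point i ω) := by
  refine @Measurable.prodMk _ Φ.sigma _ _ _ _ _ _ ?_ (@measurable_pi_lambda _ _ _ Φ.sigma _ _ ?_)
  · exact (comap_measurable _).mono le_sup_left le_rfl
  · exact fun i => (comap_measurable _).mono
      ((le_iSup (fun i => MeasurableSpace.comap (Φ.point i) inferInstance) i).trans le_sup_right)
      le_rfl

section Marks

variable {E : Type*} [MeasurableSpace E] {M : ℕ → Ω → E} {w : Plane → E → ℝ≥0∞}

lemma measurable_sumUpTo_marked (hw : Measurable (Function.uncurry w)) :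
    Measurable (Function.uncurry fun (p : ℕ∞ × (ℕ → Plane)) (u : ℕ → E) =>
      sumUpTo p.1 fun i => w (p.2 i) (u i)) := by
  have hterm : ∀ i, Measurable fun q : (ℕ∞ × (ℕ → Plane)) × (ℕ → E) => w (q.1.2 i) (q.2 i) :=
    fun i => hw.comp (f := fun q : (ℕ∞ × (ℕ → Plane)) × (ℕ → E) => (q.1.2 i, q.2 i))
      (by fun_prop)
  exact measurable_sumUpTo.comp ((by fun_prop : Measurable fun
    q : (ℕ∞ × (ℕ → Plane)) × (ℕ → E) => q.1.1).prodMk (measurable_pi_lambda _ hterm))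

lemma measurable_sumPoints_marked {m : MeasurableSpace Ω} (hΦ : Φ.sigma ≤ m)
    (hM : ∀ i, Measurable[m] (M i)) (hw : Measurable (Function.uncurry w)) :
    Measurable[m] fun ω => Φ.sumPoints (fun i => w (Φ.point i ω) (M i ω)) ω :=
  (measurable_sumUpTo_marked hw).comp
    ((measurable_count_point.mono hΦ le_rfl).prodMk (@measurable_pi_lambda _ _ _ m _ _ hM))

end Marks

variable [mΩ : MeasurableSpace Ω] {P : Measure Ω} {dens : ℝ≥0}

/-- `Φ` has the Laplace functional of a homogeneous Poisson process of density `dens` at the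
function `f`. -/
def LaplaceAt (Φ : PointProcess Ω) (P : Measure Ω) (dens : ℝ≥0) (f : Plane → ℝ≥0∞) : Prop :=
  ∫⁻ ω, expNeg (Φ.sumPoints (fun i => f (Φ.point i ω)) ω) ∂P =
    expNeg (dens * ∫⁻ x, (1 - expNeg (f x)))

namespace IsPoisson

lemma measurable_sumPoints (hΦ : Φ.IsPoisson P dens) {f : Plane → ℝ≥0∞} (hf : Measurable f) :
    Measurable fun ω => Φ.sumPoints (fun i => f (Φ.point i ω)) ω :=
  measurable_sumUpTo.comp (hΦ.measurable_count.prodMk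
    (measurable_pi_lambda _ fun i => hf.comp (hΦ.measurable_point i)))

lemma measurable_numIn (hΦ : Φ.IsPoisson P dens) {B : Set Plane} (hB : MeasurableSet B) :
    Measurable (Φ.numIn B) :=
  hΦ.measurable_sumPoints (measurable_one.indicator hB)

lemma sigma_le (hΦ : Φ.IsPoisson P dens) : Φ.sigma ≤ mΩ :=
  sup_le hΦ.measurable_count.comap_le (iSup_le fun i => (hΦ.measurable_point i).comap_le)

lemma lintegral_expNeg_numIn (hΦ : Φ.IsPoisson P dens) {B : Set Plane} (hB : MeasurableSet B)
    (hB' : volume B ≠ ⊤) (c : ℝ≥0∞) :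
    ∫⁻ ω, expNeg (c * Φ.numIn B ω) ∂P = expNeg (dens * (volume B * (1 - expNeg c))) := by
  have hm : Measurable fun x : ℝ≥0∞ => expNeg (c * x) := by fun_prop
  rw [(hΦ.hasLaw_numIn B hB hB').lintegral_comp (f := fun x => expNeg (c * x)) hm.aemeasurable,
    lintegral_map hm Measurable.of_discrete]
  simp_rw [expNeg_mul_natCast]
  rw [lintegral_pow_poissonMeasure _ (expNeg_le_one c), ENNReal.coe_mul,
    ENNReal.coe_toNNReal hB', mul_assoc]

lemma laplaceAt_of_tendsto [IsFiniteMeasure P] (hΦ : Φ.IsPoisson P dens)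
    {g : ℕ → Plane → ℝ≥0∞} {f : Plane → ℝ≥0∞} (hg : ∀ n, Measurable (g n)) (hmono : Monotone g)
    (hlim : ∀ x, Tendsto (fun n => g n x) atTop (𝓝 (f x)))
    (h : ∀ n, Φ.LaplaceAt P dens (g n)) : Φ.LaplaceAt P dens f := by
  unfold LaplaceAt at h ⊢
  have hleft := tendsto_lintegral_expNeg (P := P) (fun n => hΦ.measurable_sumPoints (hg n))
    fun ω => tendsto_sumUpTo (c := Φ.count ω) (fun n k hnk i => hmono hnk (Φ.point i ω))
      fun i => hlim (Φ.point i ω)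
  have hright : Tendsto (fun n => ∫⁻ x, (1 - expNeg (g n x))) atTop
      (𝓝 (∫⁻ x, (1 - expNeg (f x)))) := by
    refine lintegral_tendsto_of_tendsto_of_monotone
      (fun n => (measurable_const.sub (measurable_expNeg.comp (hg n))).aemeasurable)
      (ae_of_all _ fun x n k hnk => tsub_le_tsub_left (antitone_expNeg (hmono hnk x)) 1)
      (ae_of_all _ fun x => ?_)
    exact ENNReal.Tendsto.sub tendsto_const_nhds ((continuous_expNeg.tendsto _).comp (hlim x))
      (Or.inl ENNReal.one_ne_top)
  exact tendsto_nhds_unique (hleft.congr h) <| (continuous_expNeg.tendsto _).comp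
    (ENNReal.Tendsto.const_mul hright (Or.inr ENNReal.coe_ne_top))

lemma laplaceAt_sum_indicator (hΦ : Φ.IsPoisson P dens) {k : ℕ}
    {B : Fin k → Set Plane} (hB : ∀ i, MeasurableSet (B i)) (hB' : ∀ i, volume (B i) ≠ ⊤)
    (hdisj : Pairwise (Function.onFun Disjoint B)) (c : Fin k → ℝ≥0∞) :
    Φ.LaplaceAt P dens fun x => ∑ i, c i * (B i).indicator 1 x := by
  have hsum : ∀ ω, Φ.sumPoints (fun i => ∑ j, c j * (B j).indicator 1 (Φ.point i ω)) ω =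
      ∑ j, c j * Φ.numIn (B j) ω := fun ω => by
    simp_rw [numIn, sumPoints_eq_sumUpTo, ← sumUpTo_const_mul, ← sumUpTo_finsetSum]
  have hindep : iIndepFun (fun j ω => c j * Φ.numIn (B j) ω) P :=
    (hΦ.indep_numIn k B hB hB' hdisj).comp (fun j x => c j * x) fun j => by fun_prop
  unfold LaplaceAt
  simp_rw [hsum, one_sub_expNeg_sum_indicator hdisj]
  rw [lintegral_expNeg_finsetSum (fun j => (hΦ.measurable_numIn (hB j)).const_mul _) hindep,
    lintegral_finsetSum _ fun j _ => measurable_const.indicator (hB j), Finset.mul_sum, expNeg_sum]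
  refine Finset.prod_congr rfl fun j _ => ?_
  rw [hΦ.lintegral_expNeg_numIn (hB j) (hB' j), lintegral_indicator_const (hB j),
    mul_comm (volume _)]

lemma laplaceAt_simpleFunc (hΦ : Φ.IsPoisson P dens) (g : SimpleFunc Plane ℝ≥0∞)
    (hg : volume (Function.support g) ≠ ⊤) : Φ.LaplaceAt P dens g := by
  classical
  let e := (g.range.filter (· ≠ 0)).equivFin
  let y : Fin _ → ℝ≥0∞ := fun i => e.symm i
  have hy0 : ∀ i, y i ≠ 0 := fun i => (Finset.mem_filter.1 (e.symm i).2).2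
  have hy : Function.Injective y := Subtype.val_injective.comp e.symm.injective
  have hindicators := hΦ.laplaceAt_sum_indicator (B := fun i => g ⁻¹' {y i})
    (fun i => g.measurableSet_fiber _)
    (fun i => ne_top_of_le_ne_top hg (measure_mono fun x hx =>
      Function.mem_support.2 ((mem_singleton_iff.1 hx).trans_ne (hy0 i))))
    (fun i j hij => Disjoint.preimage _ (disjoint_singleton.2 (hy.ne hij))) y
  convert hindicators using 1
  ext x
  rw [e.symm.sum_comp fun y => (y : ℝ≥0∞) * (g ⁻¹' {(y : ℝ≥0∞)}).indicator 1 x,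
    Finset.sum_coe_sort _ fun y => y * (g ⁻¹' {y}).indicator 1 x, sum_range_filter_mul_indicator]

lemma laplaceAt_of_volume_support_ne_top [IsFiniteMeasure P] (hΦ : Φ.IsPoisson P dens)
    {f : Plane → ℝ≥0∞} (hf : Measurable f) (hf' : volume (Function.support f) ≠ ⊤) :
    Φ.LaplaceAt P dens f := by
  have hle : ∀ k x, SimpleFunc.eapprox f k x ≤ f x := fun k x =>
    (le_iSup (fun k => SimpleFunc.eapprox f k x) k).trans_eq (SimpleFunc.iSup_eapprox_apply hf x)
  refine hΦ.laplaceAt_of_tendsto (g := fun k => SimpleFunc.eapprox f k)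
    (fun k => SimpleFunc.measurable _) (SimpleFunc.monotone_eapprox f)
    (SimpleFunc.tendsto_eapprox hf) fun k => hΦ.laplaceAt_simpleFunc _ ?_
  refine ne_top_of_le_ne_top hf' (measure_mono fun x hx h0 => hx ?_)
  exact le_antisymm ((hle k x).trans_eq h0) zero_le

theorem laplaceAt [IsFiniteMeasure P] (hΦ : Φ.IsPoisson P dens) {f : Plane → ℝ≥0∞}
    (hf : Measurable f) : Φ.LaplaceAt P dens f := by
  refine hΦ.laplaceAt_of_tendsto (g := fun n => (Metric.ball 0 (n : ℝ)).indicator f)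
    (fun n => hf.indicator measurableSet_ball)
    (fun n k hnk => indicator_le_indicator_of_subset
      (Metric.ball_subset_ball (by exact_mod_cast hnk)) fun _ => zero_le) (fun x => ?_)
    fun n => hΦ.laplaceAt_of_volume_support_ne_top (hf.indicator measurableSet_ball)
      (ne_top_of_le_ne_top measure_ball_lt_top.ne (measure_mono support_indicator_subset))
  refine tendsto_const_nhds.congr' ?_
  filter_upwards [eventually_gt_atTop ⌈‖x‖⌉₊] with n hn
  have hx : x ∈ Metric.ball (0 : Plane) n := mem_ball_zero_iff.2 (Nat.lt_of_ceil_lt hn)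
  simp [hx]

end IsPoisson

/-- Conditionally on the points the marks are independent, so a mark acts on the Laplace
functional like the deterministic function `-log G`. -/
theorem IsPoisson.lintegral_expNeg_sumPoints_marked (hΦ : Φ.IsPoisson P dens)
    {E : Type*} [MeasurableSpace E] {M : ℕ → Ω → E} {w : Plane → E → ℝ≥0∞}
    (hM : ∀ i, Measurable (M i)) (hindep : iIndepFun M P)
    (hΦM : IndepFun (fun ω => (Φ.count ω, fun i => Φ.point i ω)) (fun ω i => M i ω) P)
    (hw : Measurable (Function.uncurry w)) {G : Plane → ℝ≥0∞}
    (hG : ∀ i x, ∫⁻ ω, expNeg (w x (M i ω)) ∂P = G x) :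
    ∫⁻ ω, expNeg (Φ.sumPoints (fun i => w (Φ.point i ω) (M i ω)) ω) ∂P =
      expNeg (dens * ∫⁻ x, (1 - G x)) := by
  have : IsProbabilityMeasure P := hindep.isProbabilityMeasure
  have hG1 : ∀ x, G x ≤ 1 := fun x => hG 0 x ▸ lintegral_expNeg_le_one _
  have hGm : Measurable G := by
    rw [← funext (hG 0)]
    exact (measurable_expNeg.comp (hw.comp (measurable_fst.prodMk
      ((hM 0).comp measurable_snd)))).lintegral_prod_right'
  have hconditional : ∀ ω, ∫⁻ ω', expNeg (sumUpTo (Φ.count ω) fun i =>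
      w (Φ.point i ω) (M i ω')) ∂P = expNeg (Φ.sumPoints (fun i => negLog (G (Φ.point i ω))) ω) :=
    fun ω => by
      have hwx : ∀ i, Measurable (w (Φ.point i ω)) := fun i => hw.comp measurable_prodMk_left
      rw [lintegral_expNeg_sumUpTo (f := fun i ω' => w (Φ.point i ω) (M i ω'))
        (fun i => (hwx i).comp (hM i)) (hindep.comp _ hwx)]
      simp_rw [hG, sumPoints_eq_sumUpTo]
  calc ∫⁻ ω, expNeg (Φ.sumPoints (fun i => w (Φ.point i ω) (M i ω)) ω) ∂P
      = ∫⁻ ω, ∫⁻ ω', expNeg (sumUpTo (Φ.count ω) fun i => w (Φ.point i ω) (M i ω')) ∂P ∂P :=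
        lintegral_comp_of_indepFun (measurable_count_point.mono hΦ.sigma_le le_rfl)
          (measurable_pi_lambda _ hM) hΦM
          (F := fun p u => expNeg (sumUpTo p.1 fun i => w (p.2 i) (u i)))
          (measurable_expNeg.comp (measurable_sumUpTo_marked hw))
    _ = ∫⁻ ω, expNeg (Φ.sumPoints (fun i => negLog (G (Φ.point i ω))) ω) ∂P :=
        lintegral_congr hconditional
    _ = expNeg (dens * ∫⁻ x, (1 - expNeg (negLog (G x)))) :=
        hΦ.laplaceAt (f := fun x => negLog (G x)) (by fun_prop)
    _ = expNeg (dens * ∫⁻ x, (1 - G x)) := by simp_rw [expNeg_negLog (hG1 _)]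

end PointProcess

/-! ## Rayleigh fading -/

section Exponential

variable {r : ℝ}

lemma expMeasure_eq_withDensity : expMeasure r = volume.withDensity (exponentialPDF r) := rfl

lemma measurable_exponentialPDF : Measurable (exponentialPDF r) :=
  (measurable_exponentialPDFReal r).ennreal_ofReal

lemma ae_pos_expMeasure : ∀ᵐ h ∂(expMeasure r), 0 < h := by
  rw [expMeasure_eq_withDensity, ae_withDensity_iff measurable_exponentialPDF]
  filter_upwards [Measure.ae_ne volume (0 : ℝ)] with h h0 hne
  by_contra hn
  exact hne (exponentialPDF_of_neg (lt_of_le_of_ne (not_lt.1 hn) h0))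

lemma exponentialPDF_mul_exp (hr : 0 < r) {u : ℝ} (hu : 0 ≤ u) (h : ℝ) :
    exponentialPDF r h * ENNReal.ofReal (Real.exp (-(h * u))) =
      ENNReal.ofReal (r / (r + u)) * exponentialPDF (r + u) h := by
  rcases lt_or_ge h 0 with hh | hh
  · simp [exponentialPDF_of_neg hh]
  · rw [exponentialPDF_of_nonneg hh, exponentialPDF_of_nonneg hh,
      ← ENNReal.ofReal_mul (by positivity), ← ENNReal.ofReal_mul (by positivity), ← mul_assoc,
      div_mul_cancel₀ r (by positivity), mul_assoc, ← Real.exp_add]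
    ring_nf

lemma lintegral_expNeg_expMeasure (hr : 0 < r) (u : ℝ≥0∞) :
    ∫⁻ h, expNeg (ENNReal.ofReal h * u) ∂(expMeasure r) =
      ENNReal.ofReal r / (ENNReal.ofReal r + u) := by
  by_cases hu : u = ⊤
  · rw [hu, add_top, ENNReal.div_top, lintegral_eq_zero_iff (by fun_prop)]
    filter_upwards [ae_pos_expMeasure] with h hh
    simp [ENNReal.mul_top, hh]
  lift u to ℝ≥0 using hu
  have hru : 0 < r + u := by positivity
  rw [expMeasure_eq_withDensity, lintegral_withDensity_eq_lintegral_mul _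
    measurable_exponentialPDF (by fun_prop)]
  calc ∫⁻ h, exponentialPDF r h * expNeg (ENNReal.ofReal h * u)
      = ∫⁻ h, ENNReal.ofReal (r / (r + u)) * exponentialPDF (r + u) h := by
        refine lintegral_congr fun h => ?_
        rcases lt_or_ge h 0 with hh | hh
        · simp [exponentialPDF_of_neg hh]
        · rw [← ENNReal.ofReal_coe_nnreal, ← ENNReal.ofReal_mul hh, expNeg_ofReal (by positivity),
            exponentialPDF_mul_exp hr u.coe_nonneg]
    _ = ENNReal.ofReal r / (ENNReal.ofReal r + u) := by
        rw [lintegral_const_mul _ measurable_exponentialPDF, lintegral_exponentialPDF_eq_one hru,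
          mul_one, ENNReal.ofReal_div_of_pos hru, ENNReal.ofReal_add hr.le u.coe_nonneg,
          ENNReal.ofReal_coe_nnreal]

lemma expMeasure_Ici (hr : 0 < r) {t : ℝ} (ht : 0 ≤ t) :
    expMeasure r (Ici t) = ENNReal.ofReal (Real.exp (-(r * t))) := by
  have : IsProbabilityMeasure (expMeasure r) := isProbabilityMeasure_expMeasure hr
  have : NullSingletonClass (expMeasure r) :=
    inferInstanceAs (NullSingletonClass (volume.withDensity (exponentialPDF r)))
  have hcdf : (0 : ℝ) ≤ 1 - Real.exp (-(r * t)) :=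
    sub_nonneg.2 (Real.exp_le_one_iff.2 (neg_nonpos.2 (by positivity)))
  rw [measure_congr Ioi_ae_eq_Ici.symm, ← compl_Iic, prob_compl_eq_one_sub measurableSet_Iic,
    ← ofReal_cdf, cdf_expMeasure_eq hr, if_pos ht, ← ENNReal.ofReal_one,
    ← ENNReal.ofReal_sub _ hcdf, sub_sub_cancel]

lemma expMeasure_setOf_le (hr : 0 < r) (J : ℝ≥0∞) :
    expMeasure r {h | J ≤ ENNReal.ofReal h} = expNeg (ENNReal.ofReal r * J) := by
  have : IsProbabilityMeasure (expMeasure r) := isProbabilityMeasure_expMeasure hr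
  by_cases hJ : J = ⊤
  · simp [hJ, hr]
  lift J to ℝ≥0 using hJ
  rcases eq_or_ne J 0 with rfl | hJ0
  · simp
  have hset : {h : ℝ | (J : ℝ≥0∞) ≤ ENNReal.ofReal h} = Ici (J : ℝ) := by
    ext h
    rw [mem_ofPred_eq, mem_Ici, ← ENNReal.ofReal_coe_nnreal, ENNReal.ofReal_le_ofReal_iff',
      or_iff_left (not_le.2 (NNReal.coe_pos.2 hJ0.bot_lt))]
  rw [hset, expMeasure_Ici hr J.coe_nonneg, ← ENNReal.ofReal_coe_nnreal,
    ← ENNReal.ofReal_mul hr.le, expNeg_ofReal (by positivity)]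

lemma measure_le_ofReal_of_indepFun_exponential {Ω : Type*} [MeasurableSpace Ω] {P : Measure Ω}
    [IsFiniteMeasure P] (hr : 0 < r) {J : Ω → ℝ≥0∞} {h : Ω → ℝ} (hJ : Measurable J)
    (hh : HasLaw h (expMeasure r) P) (hJh : IndepFun J h P) :
    P {ω | J ω ≤ ENNReal.ofReal (h ω)} = ∫⁻ ω, expNeg (ENNReal.ofReal r * J ω) ∂P := by
  have : IsProbabilityMeasure (expMeasure r) := isProbabilityMeasure_expMeasure hr
  have hset : MeasurableSet {q : ℝ≥0∞ × ℝ | q.1 ≤ ENNReal.ofReal q.2} :=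
    measurableSet_le measurable_fst (by fun_prop)
  calc P {ω | J ω ≤ ENNReal.ofReal (h ω)}
      = ((P.map J).prod (expMeasure r)) {q | q.1 ≤ ENNReal.ofReal q.2} :=
        (hJh.hasLaw_prod ⟨hJ.aemeasurable, rfl⟩ hh).measure_eq hset
    _ = ∫⁻ x, expNeg (ENNReal.ofReal r * x) ∂(P.map J) := by
        rw [Measure.prod_apply hset]
        exact lintegral_congr fun x => expMeasure_setOf_le hr x
    _ = ∫⁻ ω, expNeg (ENNReal.ofReal r * J ω) ∂P := lintegral_map (by fun_prop) hJ

end Exponential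

/-! ## Received power and clusters -/

namespace Params

variable (S : Params)

/-- The Laplace transform, in the fading coefficient, of the power received from a node at `x`;
here `c` is the product of the argument of the Laplace transform, the transmit power and `η`. -/
noncomputable def nodeLaplace (c : ℝ) (x : Plane) : ℝ≥0∞ :=
  (1 + ENNReal.ofReal c * ‖x‖ₑ ^ (-S.α))⁻¹

/-- The Laplace transform of the power received from a node that is uniformly distributed on the
disc of radius `a` about `x`, with `c` as in `nodeLaplace`. -/
noncomputable def discLaplace (c : ℝ) (x : Plane) : ℝ≥0∞ :=
  ∫⁻ y, S.nodeLaplace c (x + y) ∂(uniformDisc S.a)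

/-- The power received from a cluster about `x`, for the data `d` consisting of the number of
nodes and, for each node, its displacement from `x` and its fading coefficient. -/
noncomputable def clusterPower (x : Plane) (d : ℕ × (ℕ → Plane × ℝ)) : ℝ≥0∞ :=
  ∑ j ∈ Finset.range d.1, S.receivedPower S.Px (d.2 j).2 (x + (d.2 j).1)

@[fun_prop]
lemma measurable_nodeLaplace (c : ℝ) : Measurable (S.nodeLaplace c) := by
  unfold nodeLaplace; fun_prop

@[fun_prop]
lemma measurable_receivedPower (p : ℝ) : Measurable (Function.uncurry (S.receivedPower p)) := by
  unfold receivedPower Function.uncurry; fun_prop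

lemma measurable_receivedPower_add (p : ℝ) (x : Plane) :
    Measurable fun q : Plane × ℝ => S.receivedPower p q.2 (x + q.1) :=
  (S.measurable_receivedPower p).comp (f := fun q : Plane × ℝ => (q.2, x + q.1)) (by fun_prop)

lemma measurable_clusterPower : Measurable (Function.uncurry S.clusterPower) := by
  have hcount : Measurable fun q : ℕ × (Plane × (ℕ → Plane × ℝ)) =>
      S.clusterPower q.2.1 (q.1, q.2.2) := by
    refine measurable_from_prod_countable_right fun k => ?_
    exact Finset.measurable_fun_sum (Finset.range k)
      (f := fun j (q : Plane × (ℕ → Plane × ℝ)) =>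
        S.receivedPower S.Px (q.2 j).2 (q.1 + (q.2 j).1)) fun j _ =>
      (S.measurable_receivedPower S.Px).comp
        (f := fun q : Plane × (ℕ → Plane × ℝ) => ((q.2 j).2, q.1 + (q.2 j).1)) (by fun_prop)
  exact hcount.comp (f := fun q : Plane × (ℕ × (ℕ → Plane × ℝ)) => (q.2.1, (q.1, q.2.2)))
    (by fun_prop)

variable {S}

lemma receivedPower_eq {p : ℝ} (hp : 0 ≤ p) (h : ℝ) (x : Plane) :
    S.receivedPower p h x = ENNReal.ofReal h * (ENNReal.ofReal (p * S.η) * ‖x‖ₑ ^ (-S.α)) := by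
  rw [receivedPower, mul_right_comm, mul_comm _ h, ENNReal.ofReal_mul' (mul_nonneg hp S.η_pos.le),
    mul_assoc]

lemma lintegral_expNeg_receivedPower {s p : ℝ} (hs : 0 ≤ s) (hp : 0 ≤ p) (x : Plane) :
    ∫⁻ h, expNeg (ENNReal.ofReal s * S.receivedPower p h x) ∂(expMeasure 1) =
      S.nodeLaplace (s * p * S.η) x := by
  have hlinear : ∀ h, ENNReal.ofReal s * S.receivedPower p h x =
      ENNReal.ofReal h * (ENNReal.ofReal (s * p * S.η) * ‖x‖ₑ ^ (-S.α)) := fun h => by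
    rw [receivedPower_eq hp, mul_assoc s, ENNReal.ofReal_mul hs]
    ring
  simp_rw [hlinear]
  rw [lintegral_expNeg_expMeasure one_pos, ENNReal.ofReal_one, one_div, nodeLaplace]

end Params

/-- Labels of the independent sources of randomness of a single cluster: the number of its nodes,
and the displacement and the fading coefficient of each node. -/
inductive ClusterSource where
  | num | pos (j : ℕ) | fading (j : ℕ)

/-- The σ-algebras generated by the sources of randomness of the cluster with `N` nodes, whose
`j`-th node has displacement `y j` and fading coefficient `h j`. -/
@[reducible] def ClusterSource.sigma {Ω : Type*} (N : Ω → ℕ) (y : ℕ → Ω → Plane)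
    (h : ℕ → Ω → ℝ) : ClusterSource → MeasurableSpace Ω
  | num => MeasurableSpace.comap N inferInstance
  | pos j => MeasurableSpace.comap (y j) inferInstance
  | fading j => MeasurableSpace.comap (h j) inferInstance

namespace ClusterSource

variable {Ω : Type*} {N : Ω → ℕ} {y : ℕ → Ω → Plane} {h : ℕ → Ω → ℝ}

lemma measurable_node {T : Set ClusterSource} {j : ℕ} (hpos : .pos j ∈ T)
    (hfading : .fading j ∈ T) :
    Measurable[⨆ k ∈ T, sigma N y h k] fun ω => (y j ω, h j ω) :=
  (measurable_biSup_of_mem (i := pos j) hpos (comap_measurable (y j))).prodMk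
    (measurable_biSup_of_mem (i := fading j) hfading (comap_measurable (h j)))

end ClusterSource

/-- The random data `(N, (y j, h j)_j)` of a cluster: a random number of nodes with law `ν`, and
independent nodes with displacements uniform on the disc of radius `a` and exponential fading. -/
structure IsCluster {Ω : Type*} [mΩ : MeasurableSpace Ω] (P : Measure Ω) (S : Params)
    (ν : Measure ℕ) (N : Ω → ℕ) (y : ℕ → Ω → Plane) (h : ℕ → Ω → ℝ) : Prop where
  measurable_num : Measurable N
  measurable_pos : ∀ j, Measurable (y j)
  measurable_fading : ∀ j, Measurable (h j)
  law_num : HasLaw N ν P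
  law_pos : ∀ j, HasLaw (y j) (uniformDisc S.a) P
  law_fading : ∀ j, HasLaw (h j) (expMeasure 1) P
  indep : iIndep (ClusterSource.sigma N y h) P

namespace IsCluster

variable {Ω : Type*} [mΩ : MeasurableSpace Ω] {P : Measure Ω} {S : Params} {ν : Measure ℕ}
  {N : Ω → ℕ} {y : ℕ → Ω → Plane} {h : ℕ → Ω → ℝ}

lemma sigma_le (H : IsCluster P S ν N y h) : ∀ k, ClusterSource.sigma N y h k ≤ mΩ
  | .num => H.measurable_num.comap_le
  | .pos j => (H.measurable_pos j).comap_le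
  | .fading j => (H.measurable_fading j).comap_le

lemma indepFun_pos_fading (H : IsCluster P S ν N y h) (j : ℕ) : IndepFun (y j) (h j) P :=
  H.indep.indep (i := .pos j) (j := .fading j) (by simp)

lemma iIndepFun_node (H : IsCluster P S ν N y h) : iIndepFun (fun j ω => (y j ω, h j ω)) P :=
  iIndepFun_of_iIndep H.sigma_le H.indep (S := fun j => {.pos j, .fading j})
    (fun i j hij => by simp [Function.onFun, hij.symm])
    fun j => ClusterSource.measurable_node (by simp) (by simp)

lemma indepFun_num_nodes (H : IsCluster P S ν N y h) :
    IndepFun N (fun ω j => (y j ω, h j ω)) P := by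
  have hnum : Measurable[⨆ k ∈ ({.num} : Set ClusterSource), ClusterSource.sigma N y h k] N :=
    measurable_biSup_of_mem (i := ClusterSource.num) (mem_singleton _) (comap_measurable N)
  have hnodes : Measurable[⨆ k ∈ ({.num}ᶜ : Set ClusterSource),
      ClusterSource.sigma N y h k]
      fun ω j => (y j ω, h j ω) :=
    @measurable_pi_lambda _ _ _ (_) _ _ fun j => ClusterSource.measurable_node (by simp) (by simp)
  exact indepFun_of_iIndep H.sigma_le H.indep disjoint_compl_right hnum hnodes

lemma lintegral_expNeg_node (H : IsCluster P S ν N y h) {s : ℝ} (hs : 0 ≤ s) (x : Plane) (j : ℕ) :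
    ∫⁻ ω, expNeg (ENNReal.ofReal s * S.receivedPower S.Px (h j ω) (x + y j ω)) ∂P =
      S.discLaplace (s * S.Px * S.η) x := by
  have : IsProbabilityMeasure P := H.indep.isProbabilityMeasure
  have : IsProbabilityMeasure (expMeasure 1) := isProbabilityMeasure_expMeasure one_pos
  have hm : Measurable fun q : Plane × ℝ =>
      expNeg (ENNReal.ofReal s * S.receivedPower S.Px q.2 (x + q.1)) :=
    measurable_expNeg.comp ((S.measurable_receivedPower_add S.Px x).const_mul _)
  calc ∫⁻ ω, expNeg (ENNReal.ofReal s * S.receivedPower S.Px (h j ω) (x + y j ω)) ∂P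
      = ∫⁻ q, expNeg (ENNReal.ofReal s * S.receivedPower S.Px q.2 (x + q.1))
          ∂((uniformDisc S.a).prod (expMeasure 1)) :=
        ((H.indepFun_pos_fading j).hasLaw_prod (H.law_pos j) (H.law_fading j)).lintegral_comp
          hm.aemeasurable
    _ = S.discLaplace (s * S.Px * S.η) x := by
        rw [lintegral_prod _ hm.aemeasurable]
        simp only [Params.lintegral_expNeg_receivedPower hs S.Px_pos.le]
        rfl

lemma lintegral_expNeg_clusterPower (H : IsCluster P S ν N y h) {s : ℝ} (hs : 0 ≤ s) (x : Plane) :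
    ∫⁻ ω, expNeg (ENNReal.ofReal s * S.clusterPower x (N ω, fun j => (y j ω, h j ω))) ∂P =
      ∫⁻ k, S.discLaplace (s * S.Px * S.η) x ^ k ∂ν := by
  let power : Plane × ℝ → ℝ≥0∞ := fun q => ENNReal.ofReal s * S.receivedPower S.Px q.2 (x + q.1)
  have hpower : Measurable power := (S.measurable_receivedPower_add S.Px x).const_mul _
  have hnum : IndepFun N (fun ω j => power (y j ω, h j ω)) P :=
    H.indepFun_num_nodes.comp (φ := id) (ψ := fun (u : ℕ → Plane × ℝ) j => power (u j))
      measurable_id (measurable_pi_lambda _ fun j => hpower.comp (measurable_pi_apply j))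
  simp_rw [Params.clusterPower, Finset.mul_sum]
  rw [lintegral_expNeg_sum_range (f := fun j ω => power (y j ω, h j ω)) H.measurable_num
    (fun j => hpower.comp ((H.measurable_pos j).prodMk (H.measurable_fading j)))
    (H.iIndepFun_node.comp (fun _ => power) fun _ => hpower) hnum
    fun j => H.lintegral_expNeg_node hs x j]
  exact H.law_num.lintegral_comp (f := fun k => S.discLaplace (s * S.Px * S.η) x ^ k)
    Measurable.of_discrete.aemeasurable

end IsCluster

/-- The parts into which the sources of randomness of a network are grouped: the typical node's
position and its fading coefficient, and the three kinds of interference. -/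
inductive Part where
  | position | fading | intra | inter | coexistence

namespace Source

/-- The part of the network to which a source of randomness belongs. -/
def part : Source → Part
  | x₀ => .position
  | h₀ => .fading
  | numIntra | xIntra _ | hIntra _ => .intra
  | receivers | numInter _ | xInter _ _ | hInter _ _ => .inter
  | nonLoRa | hCo _ => .coexistence

/-- The sources of randomness of the typical cluster, other than the typical node. -/
def ofIntra : ClusterSource → Source
  | .num => numIntra
  | .pos j => xIntra j
  | .fading j => hIntra j

/-- The sources of randomness of the cluster of the `i`-th other receiver. -/
def ofInter (i : ℕ) : ClusterSource → Source
  | .num => numInter i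
  | .pos j => xInter i j
  | .fading j => hInter i j

lemma ofIntra_injective : Function.Injective ofIntra := by
  rintro (_ | i | i) (_ | j | j) <;> simp [ofIntra]

lemma ofInter_injective (i : ℕ) : Function.Injective (ofInter i) := by
  rintro (_ | k | k) (_ | l | l) <;> simp [ofInter]

lemma disjoint_range_ofInter {i j : ℕ} (hij : i ≠ j) :
    Disjoint (range (ofInter i)) (range (ofInter j)) := by
  rw [disjoint_left]
  rintro _ ⟨k, rfl⟩ ⟨l, hl⟩
  rcases k with _ | k | k <;> rcases l with _ | l | l <;> simp_all [ofInter]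

end Source

namespace Network

variable {Ω : Type*} {X : Network Ω} {S : Params}

/-- The σ-algebra generated by a set of sources of randomness. -/
@[reducible] def jointSigma (X : Network Ω) (T : Set Source) : MeasurableSpace Ω :=
  ⨆ k ∈ T, X.sigma k

lemma measurable_jointSigma (X : Network Ω) {α : Type*} [MeasurableSpace α] {f : Ω → α}
    {T : Set Source} {k : Source} (hk : k ∈ T) (hf : Measurable[X.sigma k] f) :
    Measurable[X.jointSigma T] f :=
  measurable_biSup_of_mem hk hf

/-- The total power of interference and noise. -/
noncomputable def Itot (X : Network Ω) (S : Params) (ω : Ω) : ℝ≥0∞ :=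
  X.Iintra S ω + X.Iinter S ω + X.Ico S ω + ENNReal.ofReal (S.σ ^ 2)

/-- The data of the cluster of the `i`-th other receiver, as expected by `clusterPower`. -/
def interData (X : Network Ω) (i : ℕ) (ω : Ω) : ℕ × (ℕ → Plane × ℝ) :=
  (X.numInter i ω, fun j => (X.xInter i j ω, X.hInter i j ω))

lemma Iintra_eq_clusterPower (ω : Ω) : X.Iintra S ω = S.clusterPower 0
    (X.numIntra ω, fun j => (X.xIntra j ω, X.hIntra j ω)) := by
  simp [Iintra, Params.clusterPower]

lemma Iinter_eq_sumPoints (ω : Ω) : X.Iinter S ω =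
    X.receivers.sumPoints (fun i => S.clusterPower (X.receivers.point i ω) (X.interData i ω)) ω :=
  rfl

section Measurability

variable {T : Set Source}

lemma measurable_clusterData {m : MeasurableSpace Ω} {N : Ω → ℕ} {y : ℕ → Ω → Plane}
    {h : ℕ → Ω → ℝ} (hN : Measurable[m] N) (hy : ∀ j, Measurable[m] (y j))
    (hh : ∀ j, Measurable[m] (h j)) : Measurable[m] fun ω => (N ω, fun j => (y j ω, h j ω)) :=
  hN.prodMk (@measurable_pi_lambda _ _ _ m _ _ fun j => (hy j).prodMk (hh j))

lemma measurable_interData {i : ℕ} (hT : range (Source.ofInter i) ⊆ T) :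
    Measurable[X.jointSigma T] (X.interData i) :=
  measurable_clusterData
    (X.measurable_jointSigma (hT ⟨.num, rfl⟩) (comap_measurable _))
    (fun j => X.measurable_jointSigma (hT ⟨.pos j, rfl⟩) (comap_measurable _))
    (fun j => X.measurable_jointSigma (hT ⟨.fading j, rfl⟩) (comap_measurable _))

lemma measurable_Iintra (hT : Source.part ⁻¹' {.intra} ⊆ T) :
    Measurable[X.jointSigma T] (X.Iintra S) := by
  rw [funext Iintra_eq_clusterPower]
  exact (S.measurable_clusterPower.comp measurable_prodMk_left).comp <|
    measurable_clusterData
      (X.measurable_jointSigma (k := .numIntra) (hT rfl) (comap_measurable _))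
      (fun j => X.measurable_jointSigma (k := .xIntra j) (hT rfl) (comap_measurable _))
      (fun j => X.measurable_jointSigma (k := .hIntra j) (hT rfl) (comap_measurable _))

lemma measurable_Iinter (hT : Source.part ⁻¹' {.inter} ⊆ T) :
    Measurable[X.jointSigma T] (X.Iinter S) := by
  rw [funext Iinter_eq_sumPoints]
  refine PointProcess.measurable_sumPoints_marked
    (le_biSup X.sigma (hT rfl : Source.receivers ∈ T)) (fun i => measurable_interData ?_)
    S.measurable_clusterPower
  rintro _ ⟨_ | j | j, rfl⟩ <;> exact hT rfl

lemma measurable_Ico (hT : Source.part ⁻¹' {.coexistence} ⊆ T) :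
    Measurable[X.jointSigma T] (X.Ico S) :=
  PointProcess.measurable_sumPoints_marked (w := fun x h => S.receivedPower S.Pz h x)
    (le_biSup X.sigma (hT rfl : Source.nonLoRa ∈ T))
    (fun i => X.measurable_jointSigma (k := .hCo i) (hT rfl) (comap_measurable _))
    ((S.measurable_receivedPower S.Pz).comp measurable_swap)

lemma measurable_Itot (hT : Source.part ⁻¹' {.intra, .inter, .coexistence} ⊆ T) :
    Measurable[X.jointSigma T] (X.Itot S) :=
  (((measurable_Iintra ((preimage_mono (by simp)).trans hT)).add
    (measurable_Iinter ((preimage_mono (by simp)).trans hT))).add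
    (measurable_Ico ((preimage_mono (by simp)).trans hT))).add_const _

end Measurability

end Network

lemma Params.le_receivedPower_div_iff (S : Params) {γ : ℝ} (hγ : 0 < γ) {h : ℝ} (hh : 0 < h)
    {x : Plane} (hx : x ≠ 0) (J : ℝ≥0∞) :
    ENNReal.ofReal γ ≤ S.receivedPower S.Px₀ h x / J ↔
      ENNReal.ofReal (S.ρ γ ‖x‖) * J ≤ ENNReal.ofReal h := by
  have hx' : 0 < ‖x‖ := norm_pos_iff.2 hx
  have := S.Px₀_pos
  have := S.η_pos
  set g : ℝ := S.Px₀ * S.η * ‖x‖ ^ (-S.α) with hg_def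
  have hg : 0 < g := by positivity
  have hpower : S.receivedPower S.Px₀ h x = ENNReal.ofReal h * ENNReal.ofReal g := by
    rw [S.receivedPower_eq S.Px₀_pos.le, ← ofReal_norm,
      ENNReal.ofReal_rpow_of_pos hx', ← ENNReal.ofReal_mul (by positivity)]
  have hγ_eq : ENNReal.ofReal γ = ENNReal.ofReal (S.ρ γ ‖x‖) * ENNReal.ofReal g := by
    rw [← ENNReal.ofReal_mul' hg.le, Params.ρ, hg_def, Real.rpow_neg hx'.le]
    congr 1
    field_simp
  have hg0 : ENNReal.ofReal g ≠ 0 := by simpa using hg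
  have hh0 : ENNReal.ofReal h ≠ 0 := by simpa using hh
  rw [hpower, ENNReal.le_div_iff_mul_le (Or.inr (mul_ne_zero hh0 hg0))
    (Or.inr (ENNReal.mul_ne_top ENNReal.ofReal_ne_top ENNReal.ofReal_ne_top)), hγ_eq,
    mul_right_comm, ENNReal.mul_le_mul_iff_left hg0 ENNReal.ofReal_ne_top]

namespace Network.IsMatern

variable {Ω : Type*} [mΩ : MeasurableSpace Ω] {X : Network Ω} {P : Measure Ω} {S : Params}
  {ν₀ ν : Measure ℕ}

lemma sigma_le (hX : X.IsMatern P S ν₀ ν) : ∀ k, X.sigma k ≤ mΩ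
  | .x₀ => hX.measurable_x₀.comap_le
  | .h₀ => hX.measurable_h₀.comap_le
  | .numIntra => hX.measurable_numIntra.comap_le
  | .xIntra j => (hX.measurable_xIntra j).comap_le
  | .hIntra j => (hX.measurable_hIntra j).comap_le
  | .receivers => hX.receivers_poisson.sigma_le
  | .numInter i => (hX.measurable_numInter i).comap_le
  | .xInter i j => (hX.measurable_xInter i j).comap_le
  | .hInter i j => (hX.measurable_hInter i j).comap_le
  | .nonLoRa => hX.nonLoRa_poisson.sigma_le
  | .hCo i => (hX.measurable_hCo i).comap_le

lemma jointSigma_le (hX : X.IsMatern P S ν₀ ν) (T : Set Source) : X.jointSigma T ≤ mΩ :=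
  iSup₂_le fun k _ => hX.sigma_le k

lemma indepFun_of_disjoint (hX : X.IsMatern P S ν₀ ν) {α β : Type*} [MeasurableSpace α]
    [MeasurableSpace β] {f : Ω → α} {g : Ω → β} {T U : Set Part} (hTU : Disjoint T U)
    (hf : Measurable[X.jointSigma (Source.part ⁻¹' T)] f)
    (hg : Measurable[X.jointSigma (Source.part ⁻¹' U)] g) : IndepFun f g P :=
  indepFun_of_iIndep hX.sigma_le hX.indep (hTU.preimage _) hf hg

lemma isCluster_intra (hX : X.IsMatern P S ν₀ ν) :
    IsCluster P S ν₀ X.numIntra X.xIntra X.hIntra where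
  measurable_num := hX.measurable_numIntra
  measurable_pos := hX.measurable_xIntra
  measurable_fading := hX.measurable_hIntra
  law_num := hX.law_numIntra
  law_pos := hX.law_xIntra
  law_fading := hX.law_hIntra
  indep := by
    have hsigma : ClusterSource.sigma X.numIntra X.xIntra X.hIntra = X.sigma ∘ Source.ofIntra :=
      funext fun k => by cases k <;> rfl
    exact hsigma ▸ hX.indep.precomp Source.ofIntra_injective

lemma isCluster_inter (hX : X.IsMatern P S ν₀ ν) (i : ℕ) :
    IsCluster P S ν (X.numInter i) (X.xInter i) (X.hInter i) where
  measurable_num := hX.measurable_numInter i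
  measurable_pos := hX.measurable_xInter i
  measurable_fading := hX.measurable_hInter i
  law_num := hX.law_numInter i
  law_pos := hX.law_xInter i
  law_fading := hX.law_hInter i
  indep := by
    have hsigma : ClusterSource.sigma (X.numInter i) (X.xInter i) (X.hInter i) =
        X.sigma ∘ Source.ofInter i :=
      funext fun k => by cases k <;> rfl
    exact hsigma ▸ hX.indep.precomp (Source.ofInter_injective i)

section Laplace

variable {s : ℝ}

lemma lintegral_expNeg_Iintra (hX : X.IsMatern P S ν₀ ν) (hs : 0 ≤ s) :
    ∫⁻ ω, expNeg (ENNReal.ofReal s * X.Iintra S ω) ∂P =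
      ∫⁻ k, S.discLaplace (s * S.Px * S.η) 0 ^ k ∂ν₀ := by
  simp_rw [Iintra_eq_clusterPower]
  exact hX.isCluster_intra.lintegral_expNeg_clusterPower hs 0

lemma iIndepFun_interData (hX : X.IsMatern P S ν₀ ν) : iIndepFun X.interData P :=
  iIndepFun_of_iIndep hX.sigma_le hX.indep (S := fun i => range (Source.ofInter i))
    (fun _ _ => Source.disjoint_range_ofInter) fun _ => measurable_interData subset_rfl

lemma indepFun_receivers_interData (hX : X.IsMatern P S ν₀ ν) :
    IndepFun (fun ω => (X.receivers.count ω, fun i => X.receivers.point i ω))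
      (fun ω i => X.interData i ω) P := by
  have hreceivers : Measurable[X.jointSigma {.receivers}]
      fun ω => (X.receivers.count ω, fun i => X.receivers.point i ω) :=
    X.measurable_jointSigma (mem_singleton _) PointProcess.measurable_count_point
  have hclusters : Measurable[X.jointSigma {.receivers}ᶜ] fun ω i => X.interData i ω := by
    refine @measurable_pi_lambda _ _ _ (_) _ _ fun i => measurable_interData ?_
    rintro _ ⟨_ | j | j, rfl⟩ <;> simp [Source.ofInter]
  exact indepFun_of_iIndep hX.sigma_le hX.indep disjoint_compl_right hreceivers hclusters

lemma lintegral_expNeg_Iinter (hX : X.IsMatern P S ν₀ ν) (hs : 0 ≤ s) :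
    ∫⁻ ω, expNeg (ENNReal.ofReal s * X.Iinter S ω) ∂P =
      expNeg (S.densG * ∫⁻ x, (1 - ∫⁻ k, S.discLaplace (s * S.Px * S.η) x ^ k ∂ν)) := by
  simp_rw [Iinter_eq_sumPoints, PointProcess.sumPoints_eq_sumUpTo, ← sumUpTo_const_mul]
  exact hX.receivers_poisson.lintegral_expNeg_sumPoints_marked
    (w := fun x d => ENNReal.ofReal s * S.clusterPower x d)
    (fun i => (measurable_interData subset_rfl).mono (hX.jointSigma_le _) le_rfl)
    hX.iIndepFun_interData hX.indepFun_receivers_interData (S.measurable_clusterPower.const_mul _)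
    fun i x => (hX.isCluster_inter i).lintegral_expNeg_clusterPower hs x

lemma indepFun_nonLoRa_hCo (hX : X.IsMatern P S ν₀ ν) :
    IndepFun (fun ω => (X.nonLoRa.count ω, fun i => X.nonLoRa.point i ω))
      (fun ω i => X.hCo i ω) P := by
  have hnodes : Measurable[X.jointSigma {.nonLoRa}]
      fun ω => (X.nonLoRa.count ω, fun i => X.nonLoRa.point i ω) :=
    X.measurable_jointSigma (mem_singleton _) PointProcess.measurable_count_point
  have hfading : Measurable[X.jointSigma {.nonLoRa}ᶜ] fun ω i => X.hCo i ω :=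
    @measurable_pi_lambda _ _ _ (_) _ _ fun i =>
      X.measurable_jointSigma (k := .hCo i) (by simp) (comap_measurable _)
  exact indepFun_of_iIndep hX.sigma_le hX.indep disjoint_compl_right hnodes hfading

lemma lintegral_expNeg_Ico (hX : X.IsMatern P S ν₀ ν) (hs : 0 ≤ s) :
    ∫⁻ ω, expNeg (ENNReal.ofReal s * X.Ico S ω) ∂P =
      expNeg (S.densCo * ∫⁻ x, (1 - S.nodeLaplace (s * S.Pz * S.η) x)) := by
  have hfading : iIndepFun X.hCo P :=
    hX.indep.precomp (g := Source.hCo) fun i j h => Source.hCo.inj h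
  have hm : Measurable fun q : Plane × ℝ => ENNReal.ofReal s * S.receivedPower S.Pz q.2 q.1 :=
    ((S.measurable_receivedPower S.Pz).comp measurable_swap).const_mul _
  simp_rw [Network.Ico, PointProcess.sumPoints_eq_sumUpTo, ← sumUpTo_const_mul]
  refine hX.nonLoRa_poisson.lintegral_expNeg_sumPoints_marked
    (w := fun x h => ENNReal.ofReal s * S.receivedPower S.Pz h x) hX.measurable_hCo hfading
    hX.indepFun_nonLoRa_hCo hm fun i x => ?_
  rw [← Params.lintegral_expNeg_receivedPower hs S.Pz_pos.le x]
  exact (hX.law_hCo i).lintegral_comp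
    (measurable_expNeg.comp (hm.comp measurable_prodMk_left)).aemeasurable

lemma indepFun_Iintra_Iinter (hX : X.IsMatern P S ν₀ ν) :
    IndepFun (X.Iintra S) (X.Iinter S) P :=
  hX.indepFun_of_disjoint (T := {.intra}) (U := {.inter}) (by simp) (measurable_Iintra subset_rfl)
    (measurable_Iinter subset_rfl)

lemma indepFun_Iintra_add_Iinter_Ico (hX : X.IsMatern P S ν₀ ν) :
    IndepFun (X.Iintra S + X.Iinter S) (X.Ico S) P :=
  hX.indepFun_of_disjoint (T := {.intra, .inter}) (U := {.coexistence}) (by simp)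
    ((measurable_Iintra (preimage_mono (by simp))).add
      (measurable_Iinter (preimage_mono (by simp))))
    (measurable_Ico subset_rfl)

lemma lintegral_expNeg_Itot (hX : X.IsMatern P S ν₀ ν) (hs : 0 ≤ s) :
    ∫⁻ ω, expNeg (ENNReal.ofReal s * X.Itot S ω) ∂P =
      (∫⁻ ω, expNeg (ENNReal.ofReal s * X.Iintra S ω) ∂P) *
        (∫⁻ ω, expNeg (ENNReal.ofReal s * X.Iinter S ω) ∂P) *
        (∫⁻ ω, expNeg (ENNReal.ofReal s * X.Ico S ω) ∂P) *
        ENNReal.ofReal (Real.exp (-(s * S.σ ^ 2))) := by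
  have hmul : Measurable fun I => ENNReal.ofReal s * I := measurable_const_mul _
  have hintra : Measurable (X.Iintra S) :=
    (measurable_Iintra subset_rfl).mono (hX.jointSigma_le _) le_rfl
  have hinter : Measurable (X.Iinter S) :=
    (measurable_Iinter subset_rfl).mono (hX.jointSigma_le _) le_rfl
  have hco : Measurable (X.Ico S) := (measurable_Ico subset_rfl).mono (hX.jointSigma_le _) le_rfl
  have hnoise : expNeg (ENNReal.ofReal s * ENNReal.ofReal (S.σ ^ 2)) =
      ENNReal.ofReal (Real.exp (-(s * S.σ ^ 2))) := by
    rw [← ENNReal.ofReal_mul hs, expNeg_ofReal (by positivity)]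
  have hlora : ∫⁻ ω, expNeg (ENNReal.ofReal s * (X.Iintra S ω + X.Iinter S ω)) ∂P =
      (∫⁻ ω, expNeg (ENNReal.ofReal s * X.Iintra S ω) ∂P) *
        ∫⁻ ω, expNeg (ENNReal.ofReal s * X.Iinter S ω) ∂P := by
    simp_rw [mul_add]
    exact lintegral_expNeg_add (hmul.comp hintra) (hmul.comp hinter)
      (hX.indepFun_Iintra_Iinter.comp hmul hmul)
  calc ∫⁻ ω, expNeg (ENNReal.ofReal s * X.Itot S ω) ∂P
      = ∫⁻ ω, expNeg (ENNReal.ofReal s * (X.Iintra S ω + X.Iinter S ω) +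
          ENNReal.ofReal s * X.Ico S ω) * ENNReal.ofReal (Real.exp (-(s * S.σ ^ 2))) ∂P := by
        refine lintegral_congr fun ω => ?_
        rw [← hnoise, ← expNeg_add, Itot, mul_add, mul_add]
    _ = _ := by
        rw [lintegral_mul_const' _ _ ENNReal.ofReal_ne_top, ← hlora]
        exact congrArg (· * _) <| lintegral_expNeg_add (hmul.comp (hintra.add hinter))
          (hmul.comp hco) (hX.indepFun_Iintra_add_Iinter_Ico.comp hmul hmul)

end Laplace

lemma measure_coverage (hX : X.IsMatern P S ν₀ ν) {γ : ℝ} (hγ : 0 < γ) :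
    P {ω | ENNReal.ofReal γ ≤ X.sinr S ω} =
      ∫⁻ x, ∫⁻ ω, expNeg (ENNReal.ofReal (S.ρ γ ‖x‖) * X.Itot S ω) ∂P ∂(uniformDisc S.a) := by
  have : IsProbabilityMeasure P := hX.indep.isProbabilityMeasure
  have hρ : Measurable fun x : Plane => ENNReal.ofReal (S.ρ γ ‖x‖) := by
    unfold Params.ρ; fun_prop
  have hF : Measurable fun q : Plane × ℝ≥0∞ => ENNReal.ofReal (S.ρ γ ‖q.1‖) * q.2 :=
    (hρ.comp measurable_fst).mul measurable_snd
  have hx₀ : ∀ {T : Set Part}, Part.position ∈ T →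
      Measurable[X.jointSigma (Source.part ⁻¹' T)] X.x₀ := fun h =>
    X.measurable_jointSigma (k := .x₀) h (comap_measurable _)
  have hh₀ : Measurable[X.jointSigma (Source.part ⁻¹' {.fading})] X.h₀ :=
    X.measurable_jointSigma (k := .h₀) rfl (comap_measurable _)
  have hJ : Measurable[X.jointSigma (Source.part ⁻¹' {.fading}ᶜ)] fun ω =>
      ENNReal.ofReal (S.ρ γ ‖X.x₀ ω‖) * X.Itot S ω :=
    (hρ.comp (hx₀ (by simp))).mul (measurable_Itot (preimage_mono (by simp)))
  have hI : Measurable (X.Itot S) := (measurable_Itot subset_rfl).mono (hX.jointSigma_le _) le_rfl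
  have hpos : ∀ᵐ ω ∂P, 0 < X.h₀ ω :=
    (hX.law_h₀.ae_iff (measurableSet_setOfPred.1 measurableSet_Ioi)).2 ae_pos_expMeasure
  have hne : ∀ᵐ ω ∂P, X.x₀ ω ≠ 0 :=
    (hX.law_x₀.ae_iff (p := fun x => x ≠ 0)
      (measurableSet_setOfPred.1 (measurableSet_singleton (0 : Plane)).compl)).2
      (cond_absolutelyContinuous.ae_le (Measure.ae_ne volume 0))
  have hevent : {ω | ENNReal.ofReal γ ≤ X.sinr S ω} =ᵐ[P]
      {ω | ENNReal.ofReal (S.ρ γ ‖X.x₀ ω‖) * X.Itot S ω ≤ ENNReal.ofReal (X.h₀ ω)} := by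
    rw [eventuallyEq_set]
    filter_upwards [hpos, hne] with ω hh hx
    exact S.le_receivedPower_div_iff hγ hh hx _
  calc P {ω | ENNReal.ofReal γ ≤ X.sinr S ω}
      = ∫⁻ ω, expNeg (ENNReal.ofReal (S.ρ γ ‖X.x₀ ω‖) * X.Itot S ω) ∂P := by
        rw [measure_congr hevent, measure_le_ofReal_of_indepFun_exponential one_pos
          (hJ.mono (hX.jointSigma_le _) le_rfl) hX.law_h₀
          (hX.indepFun_of_disjoint disjoint_compl_left hJ hh₀)]
        simp only [ENNReal.ofReal_one, one_mul]
    _ = ∫⁻ ω, ∫⁻ ω', expNeg (ENNReal.ofReal (S.ρ γ ‖X.x₀ ω‖) * X.Itot S ω') ∂P ∂P :=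
        lintegral_comp_of_indepFun hX.measurable_x₀ hI
          (hX.indepFun_of_disjoint (T := {.position}) (U := {.intra, .inter, .coexistence})
            (by simp) (hx₀ rfl) (measurable_Itot subset_rfl))
          (F := fun x I => expNeg (ENNReal.ofReal (S.ρ γ ‖x‖) * I)) (measurable_expNeg.comp hF)
    _ = ∫⁻ x, ∫⁻ ω, expNeg (ENNReal.ofReal (S.ρ γ ‖x‖) * X.Itot S ω) ∂P ∂(uniformDisc S.a) :=
        hX.law_x₀.lintegral_comp
          (f := fun x => ∫⁻ ω, expNeg (ENNReal.ofReal (S.ρ γ ‖x‖) * X.Itot S ω) ∂P)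
          (measurable_expNeg.comp (hF.comp
            (measurable_fst.prodMk (hI.comp measurable_snd)))).lintegral_prod_right'.aemeasurable

end Network.IsMatern

/-! ## The Beta function -/

lemma lintegral_rpow_mul_exp_neg_mul_Ioi {a r : ℝ} (ha : 0 < a) (hr : 0 < r) :
    ∫⁻ t in Ioi (0 : ℝ), ENNReal.ofReal (t ^ (a - 1) * Real.exp (-(r * t))) =
      ENNReal.ofReal ((1 / r) ^ a * Real.Gamma a) := by
  have hpos : 0 < (1 / r) ^ a * Real.Gamma a :=
    mul_pos (by positivity) (Real.Gamma_pos_of_pos ha)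
  rw [← Real.integral_rpow_mul_exp_neg_mul_Ioi ha hr] at hpos ⊢
  refine (ofReal_integral_eq_lintegral_ofReal (.of_integral_ne_zero hpos.ne') ?_).symm
  filter_upwards [ae_restrict_mem measurableSet_Ioi] with t ht
  exact mul_nonneg (Real.rpow_nonneg (le_of_lt ht) _) (Real.exp_nonneg _)

section Beta

variable {x y : ℝ}

lemma lintegral_gamma_kernel_right (hxy : 0 < x + y) {t : ℝ} (ht : 0 < t) :
    ∫⁻ s in Ioi (0 : ℝ),
        ENNReal.ofReal (t ^ (x - 1) * s ^ (x + y - 1) * Real.exp (-((1 + t) * s))) =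
      ENNReal.ofReal (Real.Gamma (x + y)) * ENNReal.ofReal (t ^ (x - 1) / (1 + t) ^ (x + y)) := by
  simp_rw [mul_assoc, ENNReal.ofReal_mul (Real.rpow_nonneg ht.le (x - 1))]
  rw [lintegral_const_mul _ (by fun_prop),
    lintegral_rpow_mul_exp_neg_mul_Ioi hxy (by positivity), ← ENNReal.ofReal_mul (by positivity),
    ← ENNReal.ofReal_mul (Real.Gamma_pos_of_pos hxy).le, one_div, Real.inv_rpow (by positivity)]
  ring_nf

lemma lintegral_gamma_kernel_left (hx : 0 < x) {s : ℝ} (hs : 0 < s) :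
    ∫⁻ t in Ioi (0 : ℝ),
        ENNReal.ofReal (t ^ (x - 1) * s ^ (x + y - 1) * Real.exp (-((1 + t) * s))) =
      ENNReal.ofReal (Real.Gamma x) * ENNReal.ofReal (s ^ (y - 1) * Real.exp (-(1 * s))) := by
  have hsplit (t : ℝ) : t ^ (x - 1) * s ^ (x + y - 1) * Real.exp (-((1 + t) * s)) =
      s ^ (x + y - 1) * Real.exp (-(1 * s)) * (t ^ (x - 1) * Real.exp (-(s * t))) := by
    rw [show -((1 + t) * s) = -(1 * s) + -(s * t) by ring, Real.exp_add]
    ring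
  have hscale : s ^ (x + y - 1) * (1 / s) ^ x = s ^ (y - 1) := by
    rw [one_div, Real.inv_rpow hs.le, ← div_eq_mul_inv, ← Real.rpow_sub hs]
    ring_nf
  have hnn : 0 ≤ s ^ (x + y - 1) * Real.exp (-(1 * s)) := by positivity
  simp_rw [hsplit, ENNReal.ofReal_mul hnn]
  rw [lintegral_const_mul _ (by fun_prop), lintegral_rpow_mul_exp_neg_mul_Ioi hx hs,
    ← ENNReal.ofReal_mul (by positivity), ← ENNReal.ofReal_mul (Real.Gamma_pos_of_pos hx).le,
    ← hscale]
  ring_nf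

-- Both sides integrate `t ^ (x - 1) * s ^ (x + y - 1) * exp (-(1 + t) * s)` over the quadrant.
lemma lintegral_rpow_div_one_add_rpow_Ioi (hx : 0 < x) (hy : 0 < y) :
    ∫⁻ t in Ioi (0 : ℝ), ENNReal.ofReal (t ^ (x - 1) / (1 + t) ^ (x + y)) =
      ENNReal.ofReal (Real.Gamma x * Real.Gamma y / Real.Gamma (x + y)) := by
  have hGx := Real.Gamma_pos_of_pos hx
  have hGxy := Real.Gamma_pos_of_pos (add_pos hx hy)
  have key : ENNReal.ofReal (Real.Gamma (x + y)) *
      ∫⁻ t in Ioi (0 : ℝ), ENNReal.ofReal (t ^ (x - 1) / (1 + t) ^ (x + y)) =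
      ENNReal.ofReal (Real.Gamma x) * ENNReal.ofReal (Real.Gamma y) := by
    rw [← lintegral_const_mul _ (by fun_prop), ← setLIntegral_congr_fun measurableSet_Ioi
        fun t ht => lintegral_gamma_kernel_right (add_pos hx hy) ht,
      lintegral_lintegral_swap (by unfold Function.uncurry; fun_prop),
      setLIntegral_congr_fun measurableSet_Ioi fun s hs => lintegral_gamma_kernel_left hx hs,
      lintegral_const_mul _ (by fun_prop), lintegral_rpow_mul_exp_neg_mul_Ioi hy one_pos]
    simp
  rw [ENNReal.ofReal_div_of_pos hGxy, ENNReal.ofReal_mul hGx.le,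
    ENNReal.eq_div_iff (by simpa using hGxy) ENNReal.ofReal_ne_top, key]

lemma betaFn_integrand_nonneg :
    0 ≤ᵐ[volume.restrict (Ioi 0)] fun t : ℝ => t ^ (x - 1) / (1 + t) ^ (x + y) := by
  filter_upwards [ae_restrict_mem measurableSet_Ioi] with t (ht : 0 < t)
  simp only [Pi.zero_apply]
  positivity

lemma betaFn_nonneg : 0 ≤ betaFn x y :=
  integral_nonneg_of_ae betaFn_integrand_nonneg

lemma betaFn_eq_Gamma (hx : 0 < x) (hy : 0 < y) :
    betaFn x y = Real.Gamma x * Real.Gamma y / Real.Gamma (x + y) := by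
  rw [betaFn, integral_eq_lintegral_of_nonneg_ae betaFn_integrand_nonneg
    (Measurable.aestronglyMeasurable (by fun_prop)), lintegral_rpow_div_one_add_rpow_Ioi hx hy,
    ENNReal.toReal_ofReal (by positivity)]

lemma lintegral_eq_ofReal_betaFn (hx : 0 < x) (hy : 0 < y) :
    ∫⁻ t in Ioi (0 : ℝ), ENNReal.ofReal (t ^ (x - 1) / (1 + t) ^ (x + y)) =
      ENNReal.ofReal (betaFn x y) := by
  rw [lintegral_rpow_div_one_add_rpow_Ioi hx hy, betaFn_eq_Gamma hx hy]

end Beta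

lemma rpow_mul_one_sub_pow_eq_sum {δ w : ℝ} (hw : 0 < w) (n : ℕ) :
    w ^ (-δ - 1) * (1 - (1 / (1 + w)) ^ n) =
      ∑ p ∈ Finset.Icc 1 n, (n.choose p : ℝ) *
        (w ^ ((p : ℝ) - δ - 1) / (1 + w) ^ ((p : ℝ) - δ + ((n : ℝ) - p + δ))) := by
  have hpos : (0 : ℝ) < (1 + w) ^ n := by positivity
  have hbinom : (1 + w) ^ n = 1 + ∑ p ∈ Finset.Icc 1 n, (n.choose p : ℝ) * w ^ p := by
    rw [add_comm 1 w, add_pow, Finset.range_eq_Ico, Finset.sum_eq_sum_Ico_succ_bot (by omega)]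
    simp only [pow_zero, one_pow, mul_one, Nat.choose_zero_right, Nat.cast_one, zero_add]
    congr 1
    exact Finset.sum_congr (by ext; simp) fun p _ => mul_comm _ _
  have hdiv : 1 - (1 / (1 + w)) ^ n =
      (∑ p ∈ Finset.Icc 1 n, (n.choose p : ℝ) * w ^ p) / (1 + w) ^ n := by
    rw [eq_div_iff hpos.ne', div_pow, one_pow, sub_mul, one_mul, div_mul_cancel₀ _ hpos.ne', hbinom]
    ring
  rw [hdiv, Finset.sum_div, Finset.mul_sum]
  refine Finset.sum_congr rfl fun p _ => ?_
  rw [show (p : ℝ) - δ + ((n : ℝ) - p + δ) = n by ring, Real.rpow_natCast,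
    show (p : ℝ) - δ - 1 = -δ - 1 + p by ring, Real.rpow_add hw, Real.rpow_natCast]
  ring

lemma lintegral_rpow_mul_one_sub_pow_Ioi {δ : ℝ} (hδ : 0 < δ) (hδ' : δ < 1) (n : ℕ) :
    ∫⁻ w in Ioi (0 : ℝ), ENNReal.ofReal (w ^ (-δ - 1) * (1 - (1 / (1 + w)) ^ n)) =
      ENNReal.ofReal (∑ p ∈ Finset.Icc 1 n, (n.choose p : ℝ) * betaFn (p - δ) (n - p + δ)) := by
  have hterm (p : ℕ) (hp : p ∈ Finset.Icc 1 n) :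
      ∫⁻ w in Ioi (0 : ℝ), ENNReal.ofReal ((n.choose p : ℝ) *
        (w ^ ((p : ℝ) - δ - 1) / (1 + w) ^ ((p : ℝ) - δ + ((n : ℝ) - p + δ)))) =
      ENNReal.ofReal ((n.choose p : ℝ) * betaFn (p - δ) (n - p + δ)) := by
    obtain ⟨h1, h2⟩ := Finset.mem_Icc.1 hp
    have h1' : (1 : ℝ) ≤ p := by exact_mod_cast h1
    have h2' : (p : ℝ) ≤ n := by exact_mod_cast h2
    simp_rw [ENNReal.ofReal_mul (Nat.cast_nonneg (α := ℝ) (n.choose p))]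
    rw [lintegral_const_mul _ (by fun_prop),
      lintegral_eq_ofReal_betaFn (by linarith) (by linarith)]
  rw [ENNReal.ofReal_sum_of_nonneg fun p _ => mul_nonneg (Nat.cast_nonneg _) betaFn_nonneg,
    ← Finset.sum_congr rfl hterm, ← lintegral_finsetSum _ fun p _ => by fun_prop]
  refine setLIntegral_congr_fun measurableSet_Ioi fun w (hw : 0 < w) => ?_
  rw [rpow_mul_one_sub_pow_eq_sum hw, ENNReal.ofReal_sum_of_nonneg fun p _ => by positivity]

/-! ## Radial integrals -/

section Radial

lemma lintegral_fun_norm_addHaar {E : Type*} [NormedAddCommGroup E] [NormedSpace ℝ E]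
    [FiniteDimensional ℝ E] [Nontrivial E] [MeasurableSpace E] [BorelSpace E] (μ : Measure E)
    [μ.IsAddHaarMeasure] {f : ℝ → ℝ≥0∞} (hf : Measurable f) :
    ∫⁻ x, f ‖x‖ ∂μ = Module.finrank ℝ E * μ (Metric.ball 0 1) *
      ∫⁻ r in Ioi (0 : ℝ), ENNReal.ofReal (r ^ (Module.finrank ℝ E - 1)) * f r := by
  calc ∫⁻ x, f ‖x‖ ∂μ
      = ∫⁻ x : ({0}ᶜ : Set E), f ‖x.1‖ ∂(μ.comap (↑)) := by
        rw [lintegral_subtype_comap (measurableSet_singleton _).compl fun x => f ‖x‖,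
          restrict_compl_singleton]
    _ = ∫⁻ x, f x.2 ∂μ.toSphere.prod (.volumeIoiPow (Module.finrank ℝ E - 1)) := by
        simpa using μ.measurePreserving_homeomorphUnitSphereProd.lintegral_comp
          (f := fun x => f x.2) (by fun_prop)
    _ = μ.toSphere univ * ∫⁻ r : Ioi (0 : ℝ), f r ∂.volumeIoiPow (Module.finrank ℝ E - 1) := by
        rw [lintegral_prod _ (by fun_prop)]
        simp only [lintegral_const, mul_comm]
    _ = _ := by
        rw [μ.toSphere_apply_univ, Measure.volumeIoiPow,
          lintegral_withDensity_eq_lintegral_mul _ (by fun_prop) (by fun_prop)]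
        congr 1
        exact lintegral_subtype_comap measurableSet_Ioi
          fun r => ENNReal.ofReal (r ^ (Module.finrank ℝ E - 1)) * f r

lemma lintegral_plane_norm {f : ℝ → ℝ≥0∞} (hf : Measurable f) :
    ∫⁻ x : Plane, f ‖x‖ =
      ENNReal.ofReal (2 * Real.pi) * ∫⁻ r in Ioi (0 : ℝ), ENNReal.ofReal r * f r := by
  rw [lintegral_fun_norm_addHaar volume hf, EuclideanSpace.volume_ball_fin_two]
  simp [ENNReal.ofReal_mul zero_le_two]

lemma lintegral_uniformDisc_norm {a : ℝ} (ha : 0 < a) {f : ℝ → ℝ≥0∞} (hf : Measurable f) :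
    ∫⁻ x, f ‖x‖ ∂(uniformDisc a) =
      ENNReal.ofReal (2 / a ^ 2) * ∫⁻ r in Ioc 0 a, ENNReal.ofReal r * f r := by
  have hind : ∫⁻ x in Metric.closedBall (0 : Plane) a, f ‖x‖ =
      ENNReal.ofReal (2 * Real.pi) * ∫⁻ r in Ioc 0 a, ENNReal.ofReal r * f r := by
    calc ∫⁻ x in Metric.closedBall (0 : Plane) a, f ‖x‖
        = ∫⁻ x : Plane, (Iic a).indicator f ‖x‖ := by
          rw [← lintegral_indicator measurableSet_closedBall]
          refine lintegral_congr fun x => ?_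
          simp [indicator]
      _ = _ := by
          rw [lintegral_plane_norm (hf.indicator measurableSet_Iic), ← Ioi_inter_Iic,
            inter_comm, ← setLIntegral_indicator measurableSet_Iic]
          simp only [indicator_mul_right]
  rw [uniformDisc, ProbabilityTheory.cond, lintegral_smul_measure, hind,
    EuclideanSpace.volume_closedBall_fin_two, ← ENNReal.ofReal_pow ha.le,
    ← ENNReal.ofReal_mul (by positivity), smul_eq_mul, ← ENNReal.ofReal_inv_of_pos (by positivity),
    ← mul_assoc, ← ENNReal.ofReal_mul (by positivity)]
  congr 2
  field_simp

variable {c p : ℝ}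

lemma injOn_mul_rpow_Ioi (hc : 0 < c) (hp : p ≠ 0) : InjOn (fun r : ℝ => c * r ^ p) (Ioi 0) :=
  fun _ hr _ hs h => (Real.rpow_left_inj (le_of_lt hr) (le_of_lt hs) hp).1
    (mul_left_cancel₀ hc.ne' h)

lemma lintegral_image_mul_rpow (hc : 0 < c) (hp : p ≠ 0) {s : Set ℝ} (hs : MeasurableSet s)
    (hs0 : s ⊆ Ioi 0) (f : ℝ → ℝ≥0∞) :
    ∫⁻ w in (fun r : ℝ => c * r ^ p) '' s, ENNReal.ofReal (w ^ (2 / p - 1)) * f w =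
      ENNReal.ofReal (|p| * c ^ (2 / p)) *
        ∫⁻ r in s, ENNReal.ofReal r * f (c * r ^ p) := by
  have hderiv (r : ℝ) (hr : r ∈ s) :
      HasDerivWithinAt (fun r : ℝ => c * r ^ p) (c * (p * r ^ (p - 1))) s r :=
    ((Real.hasDerivAt_rpow_const (.inl (hs0 hr).ne')).const_mul c).hasDerivWithinAt
  rw [lintegral_image_eq_lintegral_abs_deriv_mul hs hderiv ((injOn_mul_rpow_Ioi hc hp).mono hs0),
    ← lintegral_const_mul' _ _ ENNReal.ofReal_ne_top]
  refine setLIntegral_congr_fun hs fun r hr => ?_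
  have hr0 : 0 < r := hs0 hr
  have hjac : |c * (p * r ^ (p - 1))| * (c * r ^ p) ^ (2 / p - 1) = |p| * c ^ (2 / p) * r := by
    have hexp : r ^ (p - 1) * (r ^ p) ^ (2 / p - 1) = r := by
      rw [← Real.rpow_mul hr0.le, ← Real.rpow_add hr0,
        show p - 1 + p * (2 / p - 1) = 1 by field_simp; ring, Real.rpow_one]
    rw [abs_mul, abs_mul, abs_of_pos hc, abs_of_pos (Real.rpow_pos_of_pos hr0 _),
      Real.mul_rpow hc.le (by positivity), Real.rpow_sub_one hc.ne']
    have hcancel : c * (c ^ (2 / p) / c) = c ^ (2 / p) := mul_div_cancel₀ _ hc.ne'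
    linear_combination |p| * c ^ (2 / p) * hexp +
      |p| * r ^ (p - 1) * (r ^ p) ^ (2 / p - 1) * hcancel
  rw [← mul_assoc, ← mul_assoc (ENNReal.ofReal (|p| * _)), ← ENNReal.ofReal_mul (abs_nonneg _),
    ← ENNReal.ofReal_mul (by positivity), hjac]

lemma image_mul_rpow_Ioi (hc : 0 < c) (hp : p ≠ 0) :
    (fun r : ℝ => c * r ^ p) '' Ioi 0 = Ioi 0 := by
  refine Subset.antisymm (image_subset_iff.2 fun r (hr : 0 < r) => by
    simp only [mem_preimage, mem_Ioi]; positivity) fun w (hw : 0 < w) => ?_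
  refine ⟨(w / c) ^ p⁻¹, Real.rpow_pos_of_pos (div_pos hw hc) _, ?_⟩
  simp only
  rw [Real.rpow_inv_rpow (by positivity) hp, mul_div_cancel₀ _ hc.ne']

lemma lintegral_plane_mul_norm_rpow (hc : 0 < c) (hp : p ≠ 0) {f : ℝ → ℝ≥0∞}
    (hf : Measurable f) :
    ∫⁻ x : Plane, f (c * ‖x‖ ^ p) = ENNReal.ofReal (2 * Real.pi / |p| * c ^ (-(2 / p))) *
      ∫⁻ w in Ioi (0 : ℝ), ENNReal.ofReal (w ^ (2 / p - 1)) * f w := by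
  rw [lintegral_plane_norm (f := fun r => f (c * r ^ p)) (by fun_prop),
    ← image_mul_rpow_Ioi hc hp, lintegral_image_mul_rpow hc hp measurableSet_Ioi subset_rfl,
    ← mul_assoc, ← ENNReal.ofReal_mul (by positivity), Real.rpow_neg hc.le,
    image_mul_rpow_Ioi hc hp]
  congr 2
  field_simp

lemma image_rpow_neg_mul_rpow_Ioc {a : ℝ} (ha : 0 < a) (hp : 0 < p) :
    (fun r : ℝ => a ^ (-p) * r ^ p) '' Ioc 0 a = Ioc 0 1 := by
  have hscale {r : ℝ} (hr : 0 < r) : a ^ (-p) * r ^ p = (r / a) ^ p := by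
    rw [Real.rpow_neg ha.le, Real.div_rpow hr.le ha.le, inv_mul_eq_div]
  ext w
  constructor
  · rintro ⟨r, ⟨hr, hra⟩, rfl⟩
    simp only [hscale hr]
    exact ⟨by positivity, Real.rpow_le_one (by positivity) ((div_le_one ha).2 hra) hp.le⟩
  · rintro ⟨hw, hw1⟩
    have hpos : 0 < a * w ^ p⁻¹ := by positivity
    refine ⟨a * w ^ p⁻¹, ⟨hpos, mul_le_of_le_one_right ha.le
      (Real.rpow_le_one hw.le hw1 (inv_nonneg.2 hp.le))⟩, ?_⟩
    simp only [hscale hpos]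
    rw [mul_div_cancel_left₀ _ ha.ne', Real.rpow_inv_rpow hw.le hp.ne']

lemma lintegral_uniformDisc_norm_rpow {a : ℝ} (ha : 0 < a) (hp : 0 < p) {f : ℝ → ℝ≥0∞}
    (hf : Measurable f) :
    ∫⁻ x, f (a ^ (-p) * ‖x‖ ^ p) ∂(uniformDisc a) = ENNReal.ofReal (2 / p) *
      ∫⁻ t in Ioc (0 : ℝ) 1, ENNReal.ofReal (t ^ (2 / p - 1)) * f t := by
  have hscale : (a ^ (-p)) ^ (2 / p) = (a ^ 2)⁻¹ := by
    rw [← Real.rpow_mul ha.le, show -p * (2 / p) = -2 by field_simp, Real.rpow_neg ha.le,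
      Real.rpow_two]
  rw [lintegral_uniformDisc_norm ha (f := fun r => f (a ^ (-p) * r ^ p)) (by fun_prop),
    ← image_rpow_neg_mul_rpow_Ioc ha hp, lintegral_image_mul_rpow (by positivity) hp.ne'
      measurableSet_Ioc Ioc_subset_Ioi_self, ← mul_assoc, ← ENNReal.ofReal_mul (by positivity),
    hscale, abs_of_pos hp]
  congr 2
  field_simp

end Radial

/-! ## Averages over a probability measure -/

section Average

variable {α : Type*} [MeasurableSpace α] {μ : Measure α} [IsProbabilityMeasure μ] {f : α → ℝ≥0∞}

lemma lintegral_one_sub (hf : AEMeasurable f μ) (h1 : ∀ x, f x ≤ 1) :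
    ∫⁻ x, (1 - f x) ∂μ = 1 - ∫⁻ x, f x ∂μ := by
  have hle : ∫⁻ x, f x ∂μ ≤ 1 := (lintegral_mono h1).trans (by simp)
  rw [lintegral_sub' hf (ne_top_of_le_ne_top ENNReal.one_ne_top hle) (ae_of_all _ h1)]
  simp

lemma pow_lintegral_le_lintegral_pow (hf : AEMeasurable f μ) (n : ℕ) :
    (∫⁻ x, f x ∂μ) ^ n ≤ ∫⁻ x, f x ^ n ∂μ := by
  rcases Nat.eq_zero_or_pos n with rfl | hn
  · simp
  have hn' : (1 : ℝ) ≤ n := by exact_mod_cast hn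
  have h := eLpNorm'_le_eLpNorm'_of_exponent_le one_pos hn' μ hf.aestronglyMeasurable
  simp only [eLpNorm', enorm_eq_self, ENNReal.rpow_one, div_one, ENNReal.rpow_natCast] at h
  calc (∫⁻ x, f x ∂μ) ^ n ≤ ((∫⁻ x, f x ^ n ∂μ) ^ (1 / (n : ℝ))) ^ n := by gcongr
    _ = ∫⁻ x, f x ^ n ∂μ := by
      rw [← ENNReal.rpow_natCast, ← ENNReal.rpow_mul, one_div_mul_cancel (by positivity),
        ENNReal.rpow_one]

end Average

lemma lintegral_lintegral_add {G : Type*} [AddGroup G] [MeasurableSpace G] [MeasurableAdd₂ G]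
    (μ ν : Measure G) [SFinite μ] [μ.IsAddRightInvariant] [IsProbabilityMeasure ν]
    {f : G → ℝ≥0∞} (hf : Measurable f) : ∫⁻ x, ∫⁻ y, f (x + y) ∂ν ∂μ = ∫⁻ x, f x ∂μ := by
  rw [lintegral_lintegral_swap (Measurable.aemeasurable (by unfold Function.uncurry; fun_prop))]
  simp_rw [lintegral_add_right_eq_self]
  simp

lemma isProbabilityMeasure_uniformDisc {r : ℝ} (hr : 0 < r) :
    IsProbabilityMeasure (uniformDisc r) := by
  refine cond_isProbabilityMeasure_of_finite ?_ measure_closedBall_lt_top.ne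
  rw [EuclideanSpace.volume_closedBall_fin_two]
  simp [hr, Real.pi_pos]

/-! ## The hypergeometric integrals -/

lemma measurable_gaussHyp (a b c : ℝ) : Measurable (gaussHyp a b c) := by
  unfold gaussHyp
  simp_rw [intervalIntegral.integral_of_le zero_le_one]
  refine Measurable.const_mul (StronglyMeasurable.integral_prod_right' (f := fun q : ℝ × ℝ =>
    q.2 ^ (b - 1) * (1 - q.2) ^ (c - b - 1) * (1 - q.1 * q.2) ^ (-a)) ?_).measurable _
  exact Measurable.stronglyMeasurable (by fun_prop)

lemma gaussHyp_one {b z : ℝ} (hb : 0 < b) :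
    gaussHyp 1 b (b + 1) (-z) = b * ∫ t in (0 : ℝ)..1, t ^ (b - 1) * (1 + z * t)⁻¹ := by
  rw [gaussHyp, Real.Gamma_add_one hb.ne', add_sub_cancel_left, Real.Gamma_one, mul_one,
    mul_div_cancel_right₀ _ (Real.Gamma_pos_of_pos hb).ne']
  congr 1
  refine intervalIntegral.integral_congr fun t _ => ?_
  simp [Real.rpow_neg_one]

lemma intervalIntegrable_rpow_mul_inv {b z : ℝ} (hb : 0 < b) (hz : 0 ≤ z) :
    IntervalIntegrable (fun t : ℝ => t ^ (b - 1) * (1 + z * t)⁻¹) volume 0 1 := by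
  refine (intervalIntegral.intervalIntegrable_rpow' (by linarith)).mul_continuousOn ?_
  refine ContinuousOn.inv₀ (by fun_prop) fun t ht => ?_
  rw [uIcc_of_le zero_le_one] at ht
  have := mul_nonneg hz ht.1
  positivity

lemma ofReal_mul_lintegral_rpow_mul_inv {b z : ℝ} (hb : 0 < b) (hz : 0 ≤ z) :
    ENNReal.ofReal b *
      ∫⁻ t in Ioc (0 : ℝ) 1, ENNReal.ofReal (t ^ (b - 1)) * ENNReal.ofReal ((1 + z * t)⁻¹) =
      ENNReal.ofReal (gaussHyp 1 b (b + 1) (-z)) := by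
  rw [gaussHyp_one hb, intervalIntegral.integral_of_le zero_le_one, ENNReal.ofReal_mul hb.le,
    ofReal_integral_eq_lintegral_ofReal (intervalIntegrable_rpow_mul_inv hb hz).1]
  · congr 1
    refine setLIntegral_congr_fun measurableSet_Ioc fun t ht => ?_
    rw [← ENNReal.ofReal_mul (Real.rpow_nonneg ht.1.le _)]
  · filter_upwards [ae_restrict_mem measurableSet_Ioc] with t ⟨ht, _⟩
    simp only [Pi.zero_apply]
    positivity

namespace Params

variable (S : Params)

lemma α_pos : 0 < S.α := two_pos.trans S.two_lt_α

lemma δ_pos : 0 < S.δ := div_pos two_pos S.α_pos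

lemma δ_lt_one : S.δ < 1 := (div_lt_one S.α_pos).2 S.two_lt_α

/-! ## The Laplace transform of a single node -/

section Node

variable {c : ℝ}

lemma nodeLaplace_le_one (c : ℝ) (x : Plane) : S.nodeLaplace c x ≤ 1 :=
  ENNReal.inv_le_one.2 le_self_add

lemma nodeLaplace_eq_ofReal_of_ne_zero (hc : 0 ≤ c) {x : Plane} (hx : x ≠ 0) :
    S.nodeLaplace c x = ENNReal.ofReal (1 / (1 + c * ‖x‖ ^ (-S.α))) := by
  have hx' : 0 < ‖x‖ := norm_pos_iff.2 hx
  rw [nodeLaplace, ← ofReal_norm, ENNReal.ofReal_rpow_of_pos hx', ← ENNReal.ofReal_mul hc,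
    ← ENNReal.ofReal_one, ← ENNReal.ofReal_add zero_le_one (by positivity),
    ← ENNReal.ofReal_inv_of_pos (by positivity), one_div]

lemma nodeLaplace_zero (hc : 0 < c) : S.nodeLaplace c 0 = 0 := by
  simp [nodeLaplace, ENNReal.zero_rpow_of_neg (neg_lt_zero.2 S.α_pos), hc]

lemma nodeLaplace_eq_ofReal (hc : 0 < c) (x : Plane) :
    S.nodeLaplace c x = ENNReal.ofReal (‖x‖ ^ S.α / c * (1 + ‖x‖ ^ S.α / c)⁻¹) := by
  rcases eq_or_ne x 0 with rfl | hx
  · simp [S.nodeLaplace_zero hc, Real.zero_rpow S.α_pos.ne']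
  rw [S.nodeLaplace_eq_ofReal_of_ne_zero hc.le hx, Real.rpow_neg (norm_nonneg x)]
  congr 1
  field_simp
  ring

lemma one_sub_nodeLaplace_eq_ofReal (hc : 0 < c) (x : Plane) :
    1 - S.nodeLaplace c x = ENNReal.ofReal ((1 + ‖x‖ ^ S.α / c)⁻¹) := by
  rw [S.nodeLaplace_eq_ofReal hc, ← ENNReal.ofReal_one, ← ENNReal.ofReal_sub _ (by positivity)]
  congr 1
  field_simp
  ring

lemma lintegral_one_sub_nodeLaplace_pow (hc : 0 < c) (n : ℕ) :
    ∫⁻ x, (1 - S.nodeLaplace c x ^ n) = ENNReal.ofReal (Real.pi * c ^ S.δ * S.δ *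
      ∑ p ∈ Finset.Icc 1 n, (n.choose p : ℝ) * betaFn (p - S.δ) (n - p + S.δ)) := by
  have hδ : 2 / -S.α = -S.δ := by rw [δ, div_neg]
  have hδ₀ := S.δ_pos
  calc ∫⁻ x, (1 - S.nodeLaplace c x ^ n)
      = ∫⁻ x : Plane, ENNReal.ofReal (1 - (1 / (1 + c * ‖x‖ ^ (-S.α))) ^ n) := by
        refine lintegral_congr_ae ?_
        filter_upwards [Measure.ae_ne volume (0 : Plane)] with x hx
        rw [S.nodeLaplace_eq_ofReal_of_ne_zero hc.le hx, ENNReal.ofReal_sub _ (by positivity),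
          ENNReal.ofReal_one, ENNReal.ofReal_pow (by positivity)]
    _ = ENNReal.ofReal (Real.pi * c ^ S.δ * S.δ) * ∫⁻ w in Ioi (0 : ℝ),
          ENNReal.ofReal (w ^ (-S.δ - 1)) * ENNReal.ofReal (1 - (1 / (1 + w)) ^ n) := by
        rw [lintegral_plane_mul_norm_rpow (f := fun w => ENNReal.ofReal (1 - (1 / (1 + w)) ^ n))
          hc (neg_ne_zero.2 S.α_pos.ne') (by fun_prop), hδ, neg_neg, abs_neg, abs_of_pos S.α_pos]
        congr 2
        rw [δ]
        ring
    _ = _ := by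
        rw [ENNReal.ofReal_mul (p := Real.pi * c ^ S.δ * S.δ) (by positivity),
          ← lintegral_rpow_mul_one_sub_pow_Ioi hδ₀ S.δ_lt_one]
        congr 1
        refine setLIntegral_congr_fun measurableSet_Ioi fun w (hw : 0 < w) => ?_
        rw [ENNReal.ofReal_mul (by positivity)]

lemma lintegral_one_sub_nodeLaplace (hc : 0 < c) :
    ∫⁻ x, (1 - S.nodeLaplace c x) = ENNReal.ofReal (Real.pi * c ^ S.δ * S.δ *
      (Real.Gamma S.δ * Real.Gamma (1 - S.δ))) := by
  have hbeta := betaFn_eq_Gamma (sub_pos.2 S.δ_lt_one) S.δ_pos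
  rw [sub_add_cancel, Real.Gamma_one, div_one] at hbeta
  simpa [hbeta, mul_comm (Real.Gamma S.δ)] using S.lintegral_one_sub_nodeLaplace_pow hc 1

end Node

/-! ## The Laplace transform of a node of a cluster -/

section Disc

lemma discLaplace_le_one (c : ℝ) (x : Plane) : S.discLaplace c x ≤ 1 := by
  have := isProbabilityMeasure_uniformDisc S.a_pos
  exact (lintegral_mono fun y => S.nodeLaplace_le_one c _).trans (by simp)

lemma one_sub_discLaplace (c : ℝ) (x : Plane) :
    1 - S.discLaplace c x = ∫⁻ y, (1 - S.nodeLaplace c (x + y)) ∂(uniformDisc S.a) := by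
  have := isProbabilityMeasure_uniformDisc S.a_pos
  rw [lintegral_one_sub (by fun_prop) fun y => S.nodeLaplace_le_one c _, discLaplace]

-- Jensen's inequality for the average over the disc, which is then removed by translation.
lemma lintegral_one_sub_nodeLaplace_pow_le (c : ℝ) (n : ℕ) :
    ∫⁻ x, (1 - S.nodeLaplace c x ^ n) ≤ ∫⁻ x, (1 - S.discLaplace c x ^ n) := by
  have := isProbabilityMeasure_uniformDisc S.a_pos
  rw [← lintegral_lintegral_add volume (uniformDisc S.a) (f := fun x => 1 - S.nodeLaplace c x ^ n)
    (by fun_prop)]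
  refine lintegral_mono fun x => ?_
  rw [lintegral_one_sub (by fun_prop) fun y => pow_le_one₀ zero_le (S.nodeLaplace_le_one c _)]
  exact tsub_le_tsub_left (pow_lintegral_le_lintegral_pow (by fun_prop) n) 1

lemma lintegral_one_sub_discLaplace (c : ℝ) :
    ∫⁻ x, (1 - S.discLaplace c x) = ∫⁻ x, (1 - S.nodeLaplace c x) := by
  have := isProbabilityMeasure_uniformDisc S.a_pos
  simp_rw [one_sub_discLaplace]
  exact lintegral_lintegral_add volume (uniformDisc S.a) (f := fun x => 1 - S.nodeLaplace c x)
    (by fun_prop)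

variable {c : ℝ}

lemma rpow_div_mul_rpow_neg (r : ℝ) :
    S.a ^ S.α / c * (S.a ^ (-S.α) * r ^ S.α) = r ^ S.α / c := by
  have := (Real.rpow_pos_of_pos S.a_pos S.α).ne'
  rw [Real.rpow_neg S.a_pos.le]
  field_simp

lemma one_sub_discLaplace_zero (hc : 0 < c) :
    1 - S.discLaplace c 0 =
      ENNReal.ofReal (gaussHyp 1 S.δ (S.δ + 1) (-(S.a ^ S.α / c))) := by
  have hz : 0 ≤ S.a ^ S.α / c := div_nonneg (Real.rpow_nonneg S.a_pos.le _) hc.le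
  rw [one_sub_discLaplace, ← ofReal_mul_lintegral_rpow_mul_inv S.δ_pos hz, δ,
    ← lintegral_uniformDisc_norm_rpow S.a_pos S.α_pos
      (f := fun t => ENNReal.ofReal ((1 + S.a ^ S.α / c * t)⁻¹)) (by fun_prop)]
  refine lintegral_congr fun x => ?_
  rw [zero_add, rpow_div_mul_rpow_neg, S.one_sub_nodeLaplace_eq_ofReal hc]

lemma discLaplace_zero (hc : 0 < c) :
    S.discLaplace c 0 = ENNReal.ofReal (S.a ^ S.α * S.δ / (c * (S.δ + 1)) *
      gaussHyp 1 (S.δ + 1) (S.δ + 2) (-(S.a ^ S.α / c))) := by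
  set z := S.a ^ S.α / c with hz_def
  have hz : 0 ≤ z := div_nonneg (Real.rpow_nonneg S.a_pos.le _) hc.le
  have hδ := S.δ_pos
  have hcoef : S.a ^ S.α * S.δ / (c * (S.δ + 1)) = S.δ * z / (S.δ + 1) := by
    rw [hz_def]; field_simp
  calc S.discLaplace c 0
      = ∫⁻ x, ENNReal.ofReal (z * (S.a ^ (-S.α) * ‖x‖ ^ S.α) *
          (1 + z * (S.a ^ (-S.α) * ‖x‖ ^ S.α))⁻¹) ∂(uniformDisc S.a) := by
        refine lintegral_congr fun x => ?_
        rw [zero_add, rpow_div_mul_rpow_neg, S.nodeLaplace_eq_ofReal hc]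
    _ = ENNReal.ofReal S.δ * ∫⁻ t in Ioc (0 : ℝ) 1, ENNReal.ofReal (t ^ (S.δ - 1)) *
          ENNReal.ofReal (z * t * (1 + z * t)⁻¹) :=
        lintegral_uniformDisc_norm_rpow S.a_pos S.α_pos
          (f := fun t => ENNReal.ofReal (z * t * (1 + z * t)⁻¹)) (by fun_prop)
    _ = ENNReal.ofReal S.δ * (ENNReal.ofReal z * ∫⁻ t in Ioc (0 : ℝ) 1,
          ENNReal.ofReal (t ^ (S.δ + 1 - 1)) * ENNReal.ofReal ((1 + z * t)⁻¹)) := by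
        rw [← lintegral_const_mul (ENNReal.ofReal z) (by fun_prop)]
        congr 1
        refine setLIntegral_congr_fun measurableSet_Ioc fun t ht => ?_
        have ht₀ : 0 < t := ht.1
        rw [← ENNReal.ofReal_mul (by positivity), ← ENNReal.ofReal_mul (by positivity),
          ← ENNReal.ofReal_mul hz, add_sub_right_comm, Real.rpow_add_one ht₀.ne']
        ring_nf
    _ = _ := by
        rw [hcoef, ENNReal.ofReal_mul (by positivity), show S.δ + 2 = S.δ + 1 + 1 by ring,
          ← ofReal_mul_lintegral_rpow_mul_inv (by positivity) hz, ← mul_assoc, ← mul_assoc,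
          ← ENNReal.ofReal_mul hδ.le, ← ENNReal.ofReal_mul (by positivity),
          div_mul_cancel₀ _ (by positivity)]

end Disc

end Params

/-! ## The factors of the bounds -/

lemma expNeg_mul_ofReal (d : ℝ≥0) {A : ℝ} (hA : 0 ≤ A) :
    expNeg (d * ENNReal.ofReal A) = ENNReal.ofReal (Real.exp (-(d * A))) := by
  rw [← ENNReal.ofReal_coe_nnreal, ← ENNReal.ofReal_mul d.coe_nonneg,
    expNeg_ofReal (mul_nonneg d.coe_nonneg hA)]

lemma exp_neg_mem_unitInterval {t : ℝ} (ht : 0 ≤ t) : Real.exp (-t) ∈ unitInterval :=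
  ⟨(Real.exp_pos _).le, Real.exp_le_one_iff.2 (neg_nonpos.2 ht)⟩

lemma gaussHyp_one_nonneg {b z : ℝ} (hb : 0 < b) (hz : 0 ≤ z) :
    0 ≤ gaussHyp 1 b (b + 1) (-z) := by
  rw [gaussHyp_one hb]
  refine mul_nonneg hb.le (intervalIntegral.integral_nonneg zero_le_one fun t ht => ?_)
  have := ht.1
  positivity

namespace Params

variable (S : Params) {s : ℝ}

lemma scale_pos {p : ℝ} (hs : 0 < s) (hp : 0 < p) : 0 < s * p * S.η :=
  mul_pos (mul_pos hs hp) S.η_pos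

lemma rpow_div_scale_nonneg (hs : 0 < s) : 0 ≤ S.a ^ S.α / (s * S.Px * S.η) :=
  div_nonneg (Real.rpow_nonneg S.a_pos.le _) (S.scale_pos hs S.Px_pos).le

lemma sum_choose_mul_betaFn_nonneg (n : ℕ) :
    0 ≤ ∑ p ∈ Finset.Icc 1 n, (n.choose p : ℝ) * betaFn (p - S.δ) (n - p + S.δ) :=
  Finset.sum_nonneg fun _ _ => mul_nonneg (Nat.cast_nonneg _) betaFn_nonneg

lemma intraBase_nonneg (hs : 0 < s) : 0 ≤ S.a ^ S.α * S.δ / (s * S.Px * S.η * (S.δ + 1)) *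
    gaussHyp 1 (S.δ + 1) (S.δ + 2) (-(S.a ^ S.α / (s * S.Px * S.η))) := by
  have hc := S.scale_pos hs S.Px_pos
  have ha := S.a_pos
  have hδ := S.δ_pos
  have hF := gaussHyp_one_nonneg (b := S.δ + 1) (by positivity) (S.rpow_div_scale_nonneg hs)
  rw [show S.δ + 2 = S.δ + 1 + 1 by ring]
  positivity

lemma discLaplace_pow_eq_lapIntraFixed (hs : 0 < s) (n : ℕ) :
    S.discLaplace (s * S.Px * S.η) 0 ^ (n - 1) = ENNReal.ofReal (S.lapIntraFixed n s) := by
  rw [S.discLaplace_zero (S.scale_pos hs S.Px_pos), lapIntraFixed,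
    ENNReal.ofReal_pow (S.intraBase_nonneg hs)]

lemma lapIntraFixed_mem_unitInterval (hs : 0 < s) (n : ℕ) :
    S.lapIntraFixed n s ∈ unitInterval := by
  refine ⟨pow_nonneg (S.intraBase_nonneg hs) _, ENNReal.ofReal_le_one.1 ?_⟩
  rw [← S.discLaplace_pow_eq_lapIntraFixed hs]
  exact pow_le_one₀ zero_le (S.discLaplace_le_one _ _)

lemma expNeg_mul_one_sub_discLaplace (hs : 0 < s) {nbar : ℝ≥0} (hn : 1 ≤ nbar) :
    expNeg ((nbar - 1 : ℝ≥0) * (1 - S.discLaplace (s * S.Px * S.η) 0)) =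
      ENNReal.ofReal (S.lapIntraPoisson nbar s) := by
  rw [S.one_sub_discLaplace_zero (S.scale_pos hs S.Px_pos),
    expNeg_mul_ofReal _ (gaussHyp_one_nonneg S.δ_pos (S.rpow_div_scale_nonneg hs)),
    NNReal.coe_sub hn, NNReal.coe_one, lapIntraPoisson]

lemma lapIntraPoisson_mem_unitInterval (hs : 0 < s) {nbar : ℝ} (hn : 1 ≤ nbar) :
    S.lapIntraPoisson nbar s ∈ unitInterval :=
  exp_neg_mem_unitInterval <| mul_nonneg (sub_nonneg.2 hn)
    (gaussHyp_one_nonneg S.δ_pos (S.rpow_div_scale_nonneg hs))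

lemma expNeg_inter_le_lapInterUp (hs : 0 < s) (n : ℕ) :
    expNeg (S.densG * ∫⁻ x, (1 - S.discLaplace (s * S.Px * S.η) x ^ n)) ≤
      ENNReal.ofReal (S.lapInterUp n s) := by
  have hc := S.scale_pos hs S.Px_pos
  have hδ := S.δ_pos
  have hsum := S.sum_choose_mul_betaFn_nonneg n
  calc expNeg (S.densG * ∫⁻ x, (1 - S.discLaplace (s * S.Px * S.η) x ^ n))
      ≤ expNeg (S.densG * ∫⁻ x, (1 - S.nodeLaplace (s * S.Px * S.η) x ^ n)) :=
        antitone_expNeg (mul_le_mul_right (S.lintegral_one_sub_nodeLaplace_pow_le _ n) _)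
    _ = ENNReal.ofReal (S.lapInterUp n s) := by
        rw [S.lintegral_one_sub_nodeLaplace_pow hc, expNeg_mul_ofReal _ (by positivity),
          lapInterUp]
        congr 3
        ring

lemma lapInterLow_le_expNeg_inter (hs : 0 < s) (nbar : ℝ≥0) :
    ENNReal.ofReal (S.lapInterLow nbar s) ≤
      expNeg (S.densG * ∫⁻ x, (1 - expNeg (nbar * (1 - S.discLaplace (s * S.Px * S.η) x)))) := by
  have hc := S.scale_pos hs S.Px_pos
  have hδ := S.δ_pos
  have hΓ : 0 < Real.Gamma S.δ * Real.Gamma (1 - S.δ) :=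
    mul_pos (Real.Gamma_pos_of_pos hδ) (Real.Gamma_pos_of_pos (sub_pos.2 S.δ_lt_one))
  have hle : ∫⁻ x, (1 - expNeg (nbar * (1 - S.discLaplace (s * S.Px * S.η) x))) ≤
      nbar * ∫⁻ x, (1 - S.nodeLaplace (s * S.Px * S.η) x) := by
    rw [← S.lintegral_one_sub_discLaplace, ← lintegral_const_mul' _ _ ENNReal.coe_ne_top]
    exact lintegral_mono fun x => one_sub_expNeg_le _
  calc ENNReal.ofReal (S.lapInterLow nbar s)
      = expNeg (S.densG * (nbar * ∫⁻ x, (1 - S.nodeLaplace (s * S.Px * S.η) x))) := by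
        rw [S.lintegral_one_sub_nodeLaplace hc, ← mul_assoc, ← ENNReal.coe_mul,
          expNeg_mul_ofReal _ (by positivity), lapInterLow, Real.Gamma_mul_Gamma_one_sub,
          NNReal.coe_mul]
        ring_nf
    _ ≤ _ := antitone_expNeg (mul_le_mul_right hle _)

lemma lapInterUp_mem_unitInterval (hs : 0 < s) (n : ℕ) : S.lapInterUp n s ∈ unitInterval := by
  have hc := S.scale_pos hs S.Px_pos
  have hδ := S.δ_pos
  have hsum := S.sum_choose_mul_betaFn_nonneg n
  exact exp_neg_mem_unitInterval (by positivity)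

lemma lapInterLow_mem_unitInterval (hs : 0 < s) {nbar : ℝ} (hn : 0 ≤ nbar) :
    S.lapInterLow nbar s ∈ unitInterval := by
  have hc := S.scale_pos hs S.Px_pos
  have hδ := S.δ_pos
  have hsin : 0 < Real.sin (Real.pi * S.δ) := Real.sin_pos_of_pos_of_lt_pi (by positivity)
    (mul_lt_of_lt_one_right Real.pi_pos S.δ_lt_one)
  exact exp_neg_mem_unitInterval (by positivity)

lemma expNeg_coexistence (hs : 0 < s) :
    expNeg (S.densCo * ∫⁻ x, (1 - S.nodeLaplace (s * S.Pz * S.η) x)) =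
      ENNReal.ofReal (S.lapCo s) := by
  have hc := S.scale_pos hs S.Pz_pos
  have hδ := S.δ_pos
  have hΓ : 0 < Real.Gamma S.δ * Real.Gamma (1 - S.δ) :=
    mul_pos (Real.Gamma_pos_of_pos hδ) (Real.Gamma_pos_of_pos (sub_pos.2 S.δ_lt_one))
  rw [S.lintegral_one_sub_nodeLaplace hc, expNeg_mul_ofReal _ (by positivity), lapCo, add_comm 1,
    Real.Gamma_add_one hδ.ne']
  ring_nf

lemma lapCo_mem_unitInterval (hs : 0 < s) : S.lapCo s ∈ unitInterval :=
  ⟨(Real.exp_pos _).le, ENNReal.ofReal_le_one.1 (S.expNeg_coexistence hs ▸ expNeg_le_one _)⟩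

/-- The bound for the Laplace transform of interference and noise, `n` nodes per cluster. -/
noncomputable def lapTotUp (n : ℕ) (s : ℝ) : ℝ :=
  Real.exp (-(s * S.σ ^ 2)) * S.lapIntraFixed n s * S.lapInterUp n s * S.lapCo s

/-- The bound for the Laplace transform of interference and noise, on average `nbar` nodes per
cluster. -/
noncomputable def lapTotLow (nbar s : ℝ) : ℝ :=
  Real.exp (-(s * S.σ ^ 2)) * S.lapIntraPoisson nbar s * S.lapInterLow nbar s * S.lapCo s

lemma lapTotUp_mem_unitInterval (hs : 0 < s) (n : ℕ) : S.lapTotUp n s ∈ unitInterval :=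
  unitInterval.mul_mem (unitInterval.mul_mem (unitInterval.mul_mem
    (exp_neg_mem_unitInterval (by positivity)) (S.lapIntraFixed_mem_unitInterval hs n))
    (S.lapInterUp_mem_unitInterval hs n)) (S.lapCo_mem_unitInterval hs)

lemma lapTotLow_mem_unitInterval (hs : 0 < s) {nbar : ℝ} (hn : 1 ≤ nbar) :
    S.lapTotLow nbar s ∈ unitInterval :=
  unitInterval.mul_mem (unitInterval.mul_mem (unitInterval.mul_mem
    (exp_neg_mem_unitInterval (by positivity)) (S.lapIntraPoisson_mem_unitInterval hs hn))
    (S.lapInterLow_mem_unitInterval hs (zero_le_one.trans hn))) (S.lapCo_mem_unitInterval hs)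

@[fun_prop]
lemma measurable_lapTotUp (n : ℕ) : Measurable (S.lapTotUp n) := by
  have := measurable_gaussHyp 1 (S.δ + 1) (S.δ + 2)
  unfold lapTotUp lapIntraFixed lapInterUp lapCo
  fun_prop

@[fun_prop]
lemma measurable_lapTotLow (nbar : ℝ) : Measurable (S.lapTotLow nbar) := by
  have := measurable_gaussHyp 1 S.δ (S.δ + 1)
  unfold lapTotLow lapIntraPoisson lapInterLow lapCo
  fun_prop

end Params

namespace Network

variable {Ω : Type*} [MeasurableSpace Ω] {P : Measure Ω}
  {X : Network Ω} {S : Params} {s : ℝ}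

lemma IsMaternFixed.lintegral_expNeg_Itot_le {n : ℕ} (hX : X.IsMaternFixed P S n) (hs : 0 < s) :
    ∫⁻ ω, expNeg (ENNReal.ofReal s * X.Itot S ω) ∂P ≤ ENNReal.ofReal (S.lapTotUp n s) := by
  calc ∫⁻ ω, expNeg (ENNReal.ofReal s * X.Itot S ω) ∂P
      = ENNReal.ofReal (S.lapIntraFixed n s) *
          expNeg (S.densG * ∫⁻ x, (1 - S.discLaplace (s * S.Px * S.η) x ^ n)) *
          ENNReal.ofReal (S.lapCo s) * ENNReal.ofReal (Real.exp (-(s * S.σ ^ 2))) := by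
        rw [IsMatern.lintegral_expNeg_Itot hX hs.le, IsMatern.lintegral_expNeg_Iintra hX hs.le,
          IsMatern.lintegral_expNeg_Iinter hX hs.le, IsMatern.lintegral_expNeg_Ico hX hs.le,
          S.expNeg_coexistence hs]
        simp only [lintegral_dirac, S.discLaplace_pow_eq_lapIntraFixed hs]
    _ ≤ ENNReal.ofReal (S.lapIntraFixed n s) * ENNReal.ofReal (S.lapInterUp n s) *
          ENNReal.ofReal (S.lapCo s) * ENNReal.ofReal (Real.exp (-(s * S.σ ^ 2))) := by
        gcongr
        exact S.expNeg_inter_le_lapInterUp hs n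
    _ = ENNReal.ofReal (S.lapTotUp n s) := by
        rw [Params.lapTotUp, ENNReal.ofReal_mul' (S.lapCo_mem_unitInterval hs).1,
          ENNReal.ofReal_mul' (S.lapInterUp_mem_unitInterval hs n).1,
          ENNReal.ofReal_mul' (S.lapIntraFixed_mem_unitInterval hs n).1]
        ring

lemma IsMaternPoisson.le_lintegral_expNeg_Itot {nbar : ℝ≥0} (hX : X.IsMaternPoisson P S nbar)
    (hn : 1 ≤ nbar) (hs : 0 < s) :
    ENNReal.ofReal (S.lapTotLow nbar s) ≤ ∫⁻ ω, expNeg (ENNReal.ofReal s * X.Itot S ω) ∂P := by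
  calc ENNReal.ofReal (S.lapTotLow nbar s)
      = ENNReal.ofReal (S.lapIntraPoisson nbar s) * ENNReal.ofReal (S.lapInterLow nbar s) *
          ENNReal.ofReal (S.lapCo s) * ENNReal.ofReal (Real.exp (-(s * S.σ ^ 2))) := by
        rw [Params.lapTotLow, ENNReal.ofReal_mul' (S.lapCo_mem_unitInterval hs).1,
          ENNReal.ofReal_mul' (S.lapInterLow_mem_unitInterval hs nbar.coe_nonneg).1,
          ENNReal.ofReal_mul' (S.lapIntraPoisson_mem_unitInterval hs (by exact_mod_cast hn)).1]
        ring
    _ ≤ ENNReal.ofReal (S.lapIntraPoisson nbar s) * expNeg (S.densG * ∫⁻ x,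
            (1 - expNeg (nbar * (1 - S.discLaplace (s * S.Px * S.η) x)))) *
          ENNReal.ofReal (S.lapCo s) * ENNReal.ofReal (Real.exp (-(s * S.σ ^ 2))) := by
        gcongr
        exact S.lapInterLow_le_expNeg_inter hs nbar
    _ = ∫⁻ ω, expNeg (ENNReal.ofReal s * X.Itot S ω) ∂P := by
        rw [IsMatern.lintegral_expNeg_Itot hX hs.le, IsMatern.lintegral_expNeg_Iintra hX hs.le,
          IsMatern.lintegral_expNeg_Iinter hX hs.le, IsMatern.lintegral_expNeg_Ico hX hs.le,
          S.expNeg_coexistence hs]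
        simp only [lintegral_pow_poissonMeasure _ (S.discLaplace_le_one _ _),
          S.expNeg_mul_one_sub_discLaplace hs hn]

end Network

/-! ## Averaging over the position of the typical node -/

section Average

variable {a : ℝ} {K : ℝ → ℝ}

lemma ae_uniformDisc_norm_pos (a : ℝ) : ∀ᵐ x ∂(uniformDisc a), 0 < ‖x‖ := by
  filter_upwards [cond_absolutelyContinuous.ae_le (Measure.ae_ne volume (0 : Plane))] with x hx
  exact norm_pos_iff.2 hx

lemma intervalIntegrable_mul_self (ha : 0 ≤ a) (hK : Measurable K)
    (hmem : ∀ r, 0 < r → K r ∈ unitInterval) :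
    IntervalIntegrable (fun r => K r * r) volume 0 a := by
  refine intervalIntegral.intervalIntegrable_id.mono_fun (by fun_prop) ?_
  rw [uIoc_of_le ha]
  filter_upwards [ae_restrict_mem measurableSet_Ioc] with r hr
  obtain ⟨h0, h1⟩ := hmem r hr.1
  rw [norm_mul, Real.norm_of_nonneg h0]
  exact mul_le_of_le_one_left (norm_nonneg r) h1

lemma lintegral_uniformDisc_ofReal_norm (ha : 0 < a) (hK : Measurable K)
    (hmem : ∀ r, 0 < r → K r ∈ unitInterval) :
    ∫⁻ x, ENNReal.ofReal (K ‖x‖) ∂(uniformDisc a) =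
      ENNReal.ofReal (2 / a ^ 2 * ∫ r in (0 : ℝ)..a, K r * r) := by
  have hnn : ∀ᵐ r ∂volume.restrict (Ioc 0 a), 0 ≤ K r * r := by
    filter_upwards [ae_restrict_mem measurableSet_Ioc] with r hr
    exact mul_nonneg (hmem r hr.1).1 hr.1.le
  rw [lintegral_uniformDisc_norm ha (f := fun r => ENNReal.ofReal (K r)) (by fun_prop),
    ENNReal.ofReal_mul (by positivity), intervalIntegral.integral_of_le ha.le,
    ofReal_integral_eq_lintegral_ofReal (intervalIntegrable_mul_self ha.le hK hmem).1 hnn]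
  congr 1
  refine setLIntegral_congr_fun measurableSet_Ioc fun r hr => ?_
  rw [mul_comm (K r), ENNReal.ofReal_mul hr.1.le]

end Average

namespace Params

variable (S : Params) {γ : ℝ}

lemma ρ_pos {r : ℝ} (hγ : 0 < γ) (hr : 0 < r) : 0 < S.ρ γ r :=
  div_pos (mul_pos (Real.rpow_pos_of_pos hr _) hγ) (mul_pos S.Px₀_pos S.η_pos)

@[fun_prop]
lemma measurable_ρ (γ : ℝ) : Measurable (S.ρ γ) := by
  unfold ρ; fun_prop

lemma intervalIntegrable_integrandUp (n : ℕ) (hγ : 0 < γ) :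
    IntervalIntegrable (S.integrandUp n γ) volume 0 S.a :=
  intervalIntegrable_mul_self (K := fun r => S.lapTotUp n (S.ρ γ r)) S.a_pos.le (by fun_prop)
    fun _ hr => S.lapTotUp_mem_unitInterval (S.ρ_pos hγ hr) n

lemma intervalIntegrable_integrandLow {nbar : ℝ} (hn : 1 ≤ nbar) (hγ : 0 < γ) :
    IntervalIntegrable (S.integrandLow nbar γ) volume 0 S.a :=
  intervalIntegrable_mul_self (K := fun r => S.lapTotLow nbar (S.ρ γ r)) S.a_pos.le (by fun_prop)
    fun _ hr => S.lapTotLow_mem_unitInterval (S.ρ_pos hγ hr) hn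

end Params

namespace Network

variable {Ω : Type*} [MeasurableSpace Ω] {P : Measure Ω}
  {X : Network Ω} {S : Params} {γ : ℝ}

section Bound

variable {ν₀ ν : Measure ℕ} {K : ℝ → ℝ}

lemma IsMatern.coverageProb_le (hX : X.IsMatern P S ν₀ ν) (hγ : 0 < γ) (hK : Measurable K)
    (hmem : ∀ s, 0 < s → K s ∈ unitInterval)
    (hle : ∀ s, 0 < s →
      ∫⁻ ω, expNeg (ENNReal.ofReal s * X.Itot S ω) ∂P ≤ ENNReal.ofReal (K s)) :
    X.coverageProb S P γ ≤ 2 / S.a ^ 2 * ∫ r in (0 : ℝ)..S.a, K (S.ρ γ r) * r := by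
  have hmem' (r : ℝ) (hr : 0 < r) : K (S.ρ γ r) ∈ unitInterval := hmem _ (S.ρ_pos hγ hr)
  have hnn : 0 ≤ ∫ r in (0 : ℝ)..S.a, K (S.ρ γ r) * r := by
    rw [intervalIntegral.integral_of_le S.a_pos.le]
    exact setIntegral_nonneg measurableSet_Ioc fun r hr => mul_nonneg (hmem' r hr.1).1 hr.1.le
  refine ENNReal.toReal_le_of_le_ofReal (by positivity) ?_
  rw [hX.measure_coverage hγ, ← lintegral_uniformDisc_ofReal_norm S.a_pos (by fun_prop) hmem']
  refine lintegral_mono_ae ?_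
  filter_upwards [ae_uniformDisc_norm_pos S.a] with x hx
  exact hle _ (S.ρ_pos hγ hx)

lemma IsMatern.le_coverageProb (hX : X.IsMatern P S ν₀ ν) (hγ : 0 < γ) (hK : Measurable K)
    (hmem : ∀ s, 0 < s → K s ∈ unitInterval)
    (hle : ∀ s, 0 < s →
      ENNReal.ofReal (K s) ≤ ∫⁻ ω, expNeg (ENNReal.ofReal s * X.Itot S ω) ∂P) :
    2 / S.a ^ 2 * ∫ r in (0 : ℝ)..S.a, K (S.ρ γ r) * r ≤ X.coverageProb S P γ := by
  have : IsProbabilityMeasure P := hX.indep.isProbabilityMeasure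
  refine (ENNReal.ofReal_le_iff_le_toReal (measure_ne_top _ _)).1 ?_
  rw [hX.measure_coverage hγ, ← lintegral_uniformDisc_ofReal_norm S.a_pos (by fun_prop)
    fun r hr => hmem _ (S.ρ_pos hγ hr)]
  refine lintegral_mono_ae ?_
  filter_upwards [ae_uniformDisc_norm_pos S.a] with x hx
  exact hle _ (S.ρ_pos hγ hx)

end Bound

lemma IsMaternFixed.coverageProb_le {n : ℕ} (hX : X.IsMaternFixed P S n) (hγ : 0 < γ) :
    X.coverageProb S P γ ≤ 2 / S.a ^ 2 * ∫ r in (0 : ℝ)..S.a, S.integrandUp n γ r :=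
  IsMatern.coverageProb_le hX hγ (S.measurable_lapTotUp n)
    (fun _ hs => S.lapTotUp_mem_unitInterval hs n) fun _ hs => hX.lintegral_expNeg_Itot_le hs

lemma IsMaternPoisson.le_coverageProb {nbar : ℝ≥0} (hX : X.IsMaternPoisson P S nbar)
    (hn : 1 ≤ nbar) (hγ : 0 < γ) :
    2 / S.a ^ 2 * ∫ r in (0 : ℝ)..S.a, S.integrandLow nbar γ r ≤ X.coverageProb S P γ :=
  IsMatern.le_coverageProb hX hγ (S.measurable_lapTotLow nbar)
    (fun _ hs => S.lapTotLow_mem_unitInterval hs (by exact_mod_cast hn))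
    fun _ hs => hX.le_lintegral_expNeg_Itot hn hs

end Network

end LoRa

theorem theorem1 {Ω : Type*} [MeasurableSpace Ω] (P : Measure Ω) [IsProbabilityMeasure P]
    (S : LoRa.Params) (X : LoRa.Network Ω) (γ : ℝ) (hγ : 0 < γ) :
    (∀ n : ℕ, 1 ≤ n → X.IsMaternFixed P S n →
      IntervalIntegrable (S.integrandUp n γ) volume 0 S.a ∧
      X.coverageProb S P γ ≤ 2 / S.a ^ 2 * ∫ r in (0 : ℝ)..S.a, S.integrandUp n γ r) ∧
    (∀ nbar : ℝ≥0, 1 ≤ nbar → X.IsMaternPoisson P S nbar →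
      IntervalIntegrable (S.integrandLow nbar γ) volume 0 S.a ∧
      2 / S.a ^ 2 * ∫ r in (0 : ℝ)..S.a, S.integrandLow nbar γ r ≤ X.coverageProb S P γ) := by
  constructor
  · intro n _ hX
    exact ⟨S.intervalIntegrable_integrandUp n hγ, hX.coverageProb_le hγ⟩
  · intro nbar hn hX
    exact ⟨S.intervalIntegrable_integrandLow (by exact_mod_cast hn) hγ,
      hX.le_coverageProb hn hγ⟩
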